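/- For $a,b\in\mathbb N_0$ with either $a=b=0$ or $a\ge 1$ and $b<\varphi(a)$ ($\varphi$ is Euler's totient function) put $f_0^0(x)=\frac1x$ and otherwise $f_a^b(x)=\frac{x^b}{\Phi_a(x)}$, where $\Phi_a$ is the $a$-th cyclotomic polynomial. For a finite sequence $m_1,\dots,m_k$ of such pairs $m_i=(a_i,b_i)$ and $x\in(0,1)$ the cyclotomic polylogarithm is defined recursively by $H(x)=1$ for the empty sequence, $H_{m_1,\dots,m_k}(x)=\frac{(\log x)^k}{k!}$ if all $m_i=(0,0)$, and $H_{m_1,\dots,m_k}(x)=\int_0^x f_{a_1}^{b_1}(y)\,H_{m_2,\dots,m_k}(y)\,dy$ otherwise; whenever the limit exists, put $H_{m_1,\dots,m_k}(1)=\lim_{x\to1^-}H_{m_1,\dots,m_k}(x)$. For integers $r\ge0$ and $c_1,\dots,c_r\ge1$ let $$S_{c_1,\dots,c_r}(n)=\sum_{i_1=1}^n\frac1{i_1^{c_1}}\sum_{i_2=1}^{i_1}\frac1{i_2^{c_2}}\cdots\sum_{i_r=1}^{i_{r-1}}\frac1{i_r^{c_r}}$$ (equal to $1$ if $r=0$),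 and let $(p)_n=p(p+1)\cdots(p+n-1)$. **Theorem.** Let $q\in\mathbb Z\setminus\{0\}$, $b,d\in\mathbb Z$, $c\in\mathbb N_0$, $r\ge 0$ and $c_1,\dots,c_r\ge1$. If the series $$\sum_{n=1}^\infty\frac{\left(\frac1q\right)_n}{(n+b)^c\,(n+d)!}\,S_{c_1,\dots,c_r}(n)$$ converges, where the terms with $n+d<0$, and, if $c\ge1$, the term with $n+b=0$, are omitted, then its value is a polynomial expression with rational coefficients in finitely many (convergent) cyclotomic polylogarithms at one $H_{m_1,\dots,m_k}(1)$. -/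

import Mathlib

open Filter Topology

noncomputable section

namespace PochhammerSums

/-- The multiple harmonic sum `S_{c₁,…,c_r}(n) = ∑_{i₁=1}^n 1/i₁^{c₁} ∑_{i₂=1}^{i₁} 1/i₂^{c₂} ⋯`;
for the empty index list it is `1`. -/
def multipleHarmonicSum : List ℕ → ℕ → ℝ
  | [], _ => 1
  | k :: ks, n => ∑ i ∈ Finset.Icc 1 n, 1 / (i : ℝ) ^ k * multipleHarmonicSum ks i

/-- The `n`-th summand `(1/q)_n / ((n+b)^c (n+d)!) * S_{c₁,…,c_r}(n)`. As usual `1/(n+d)!` is read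
as `0` when `n + d` is negative. A summand with `c ≠ 0` and `n + b = 0` has no meaning and is left
out of the series, that is, replaced by `0`. -/
def summand (q b d : ℤ) (c : ℕ) (cs : List ℕ) (n : ℕ) : ℝ :=
  if (n : ℤ) + d < 0 ∨ (c ≠ 0 ∧ (n : ℤ) + b = 0) then 0
  else (ascPochhammer ℝ n).eval (1 / (q : ℝ)) /
      (((n : ℝ) + (b : ℝ)) ^ c * (Nat.factorial ((n : ℤ) + d).toNat : ℝ)) *
    multipleHarmonicSum cs n

/-- The admissible indices: `(0,0)`, and `(a,b)` with `b < φ(a)` (so that `a ≥ 1`). -/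
def IsLetter (m : ℕ × ℕ) : Prop :=
  m = (0, 0) ∨ m.2 < Nat.totient m.1

/-- The function `f_a^b`: `1/x` for `a = b = 0` and `x^b / Φ_a(x)` otherwise. -/
def letter (m : ℕ × ℕ) (x : ℝ) : ℝ :=
  if m = (0, 0) then 1 / x else x ^ m.2 / (Polynomial.cyclotomic m.1 ℝ).eval x

/-- The cyclotomic polylogarithm `H_{m₁,…,m_k}(x)` for `0 < x < 1`. -/
def cyclotomicPolylog : List (ℕ × ℕ) → ℝ → ℝ
  | [], _ => 1
  | m :: w, x =>
      if ∀ l ∈ m :: w, l = (0, 0) then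
        (Real.log x) ^ (m :: w).length / (Nat.factorial (m :: w).length : ℝ)
      else ∫ y in (0 : ℝ)..x, letter m y * cyclotomicPolylog w y

/-- The cyclotomic polylogarithms at one: the values `lim_{x → 1⁻} H_{m₁,…,m_k}(x)`, for all words
of admissible indices for which this limit exists. -/
def cyclotomicPolylogsAtOne : Set ℝ :=
  {v | ∃ w : List (ℕ × ℕ), (∀ m ∈ w, IsLetter m) ∧
    Tendsto (cyclotomicPolylog w) (𝓝[<] (1 : ℝ)) (𝓝 v)}

end PochhammerSums

end

/-!
The series is evaluated by writing its terms as coefficients of iterated integrals. Let `0 < k ≤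
s`, `p = k / s` and `x = 1 - y ^ s`. For the generating functions `F_{c,cs}(x) = ∑ (p)_n / n! *
S_{cs}(n) / n ^ c * x ^ n`, raising `c` is integration against `dx / x`, and adding a first index
to `cs` amounts to solving a linear differential equation of first order with integrating factor
`(1 - x) ^ p = y ^ k`. In the variable `y` all the kernels become rational, of the form `y ^ j /
(1 - y ^ s)` with `-1 ≤ j < s` (`hasDerivAt_genFun_succ`, `hasDerivAt_pow_mul_genFun`), and by
partial fractions over the cyclotomic factors of `1 - y ^ s` these are rational combinations of
letters. So `F_{c,cs}(1 - y ^ s)` is an iterated integral from `y` to `1` over letters, called a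
dual polylogarithm here.

The point `x = 1` is `y = 0`. There, a dual polylogarithm is converted to ordinary polylogarithms
at one, which are iterated integrals from `0`, by repeated integration by parts
(`IsDualPolylog.exists_primitive`). All words that occur converge separately: the pole at `y = 1`
of the innermost kernel cancels, and the outermost kernel has no pole at `y = 0`. Abel's theorem
then gives the sum of `(p)_n / n! * S_{cs}(n) / n ^ c` (`exists_hasSum_coeff`).

General rational weights are reduced to `1 / n ^ c` by summation by parts
(`HasPolylogSum.telescope`): up to sums over shorter lists `cs`, it relates the denominators `(n +
b) ^ c` and `(n + b + 1) ^ c`, and together with partial fractions it covers every rational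
function with integer poles that decays fast enough (`hasPolylogSum_linFrac`). If the weight
decays too slowly, comparison with the harmonic series shows that the series diverges. For `q > 0`
take `k = 1` and `s = q`; for `q < 0` a shift of the summation index replaces `1 / q` by `1 / q +
1`, which lies in `[0, 1)`.
-/

namespace PochhammerSums

open Set Asymptotics

/-! ### Rational functions spanned by letters -/

/-- The rational span of the letters whose indices do not belong to `E`. -/
noncomputable def letterSpan (E : Set (ℕ × ℕ)) : Submodule ℚ (ℝ → ℝ) :=
  Submodule.span ℚ {g | ∃ m, IsLetter m ∧ m ∉ E ∧ g = letter m}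

lemma letterSpan_anti {E F : Set (ℕ × ℕ)} (h : E ⊆ F) : letterSpan F ≤ letterSpan E :=
  Submodule.span_mono fun _ ⟨m, h1, h2, h3⟩ => ⟨m, h1, fun hm => h2 (h hm), h3⟩

lemma letter_mem_letterSpan {E : Set (ℕ × ℕ)} {m : ℕ × ℕ} (hm : IsLetter m) (hE : m ∉ E) :
    letter m ∈ letterSpan E :=
  Submodule.subset_span ⟨m, hm, hE, rfl⟩

lemma letter_zero (x : ℝ) : letter (0, 0) x = 1 / x := by simp [letter]

lemma letter_of_pos {a : ℕ} (ha : 0 < a) (b : ℕ) (x : ℝ) :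
    letter (a, b) x = x ^ b / (Polynomial.cyclotomic a ℝ).eval x := by
  simp [letter, ha.ne']

lemma cyclotomic_eval_pos_of_two_le {a : ℕ} (ha : 2 ≤ a) {x : ℝ} (hx : 0 ≤ x) :
    0 < (Polynomial.cyclotomic a ℝ).eval x := by
  rcases ha.eq_or_lt with rfl | h
  · simp [Polynomial.cyclotomic_two]; linarith
  · exact Polynomial.cyclotomic_pos h x

lemma cyclotomic_eval_ne_zero {a : ℕ} (ha : 0 < a) {x : ℝ} (hx : x ∈ Ioo (0 : ℝ) 1) :
    (Polynomial.cyclotomic a ℝ).eval x ≠ 0 := by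
  rcases Nat.lt_or_ge a 2 with h | h
  · obtain rfl : a = 1 := by omega
    simp [Polynomial.cyclotomic_one, sub_eq_zero, hx.2.ne]
  · exact (cyclotomic_eval_pos_of_two_le h hx.1.le).ne'

open Polynomial in
/-- Partial fractions: a proper fraction whose denominator is a product of distinct cyclotomic
polynomials is a rational combination of letters. -/
lemma exists_letterSpan_eq_div_prod {E : Set (ℕ × ℕ)} (D : Finset ℕ) (hD : ∀ a ∈ D, 0 < a)
    (hE : ∀ a ∈ D, ∀ b, (a, b) ∉ E) (f : ℚ[X])
    (hf : f.degree < (∏ a ∈ D, cyclotomic a ℚ).degree) :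
    ∃ g ∈ letterSpan E, ∀ y ∈ Ioo (0 : ℝ) 1,
      g y = aeval y f / ∏ a ∈ D, (cyclotomic a ℝ).eval y := by
  classical
  obtain ⟨Q, r, hr, hfr⟩ := eq_quo_mul_prod_add_sum_rem_mul_prod (s := D) f
    (g := fun a => cyclotomic a ℚ) (fun a _ => cyclotomic.monic a ℚ)
    (fun a _ b _ hab => cyclotomic.isCoprime_rat hab)
  have hmon : (∏ a ∈ D, cyclotomic a ℚ).Monic :=
    monic_prod_of_monic _ _ fun a _ => cyclotomic.monic a ℚ
  -- the polynomial part vanishes by comparison of degrees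
  have hsum : (∑ i ∈ D, r i * ∏ k ∈ D.erase i, cyclotomic k ℚ).degree
      < (∏ a ∈ D, cyclotomic a ℚ).degree := by
    refine (degree_sum_le _ _).trans_lt ?_
    rw [Finset.sup_lt_iff]
    · intro i hi
      rw [← Finset.mul_prod_erase D _ hi, degree_mul, degree_mul]
      refine WithBot.add_lt_add_right ?_ (hr i hi)
      exact degree_ne_bot.2 (monic_prod_of_monic _ _ fun a _ => cyclotomic.monic a ℚ).ne_zero
    · exact bot_lt_iff_ne_bot.2 (degree_ne_bot.2 hmon.ne_zero)
  have hQ : Q = 0 := by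
    by_contra hQ
    have h1 : (Q * ∏ a ∈ D, cyclotomic a ℚ).degree < (∏ a ∈ D, cyclotomic a ℚ).degree := by
      have : Q * ∏ a ∈ D, cyclotomic a ℚ
          = f - ∑ i ∈ D, r i * ∏ k ∈ D.erase i, cyclotomic k ℚ := by
        rw [eq_sub_iff_add_eq]; exact hfr.symm
      rw [this]
      exact (degree_sub_le _ _).trans_lt (max_lt hf hsum)
    rw [degree_mul] at h1
    have h2 : (0 : WithBot ℕ) ≤ Q.degree := zero_le_degree_iff.2 hQ
    have h3 := add_le_add_left h2 (∏ a ∈ D, cyclotomic a ℚ).degree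
    rw [zero_add] at h3
    exact absurd h1 (not_lt.2 h3)
  refine ⟨∑ a ∈ D, ∑ b ∈ Finset.range (Nat.totient a), (r a).coeff b • letter (a, b), ?_, ?_⟩
  · refine Submodule.sum_mem _ fun a ha => Submodule.sum_mem _ fun b hb =>
      Submodule.smul_mem _ _ (letter_mem_letterSpan (Or.inr ?_) (hE a ha b))
    simpa using hb
  · intro y hy
    have hne : ∀ a ∈ D, (cyclotomic a ℝ).eval y ≠ 0 := fun a ha =>
      cyclotomic_eval_ne_zero (hD a ha) hy
    have hcyc : ∀ a, aeval y (cyclotomic a ℚ) = (cyclotomic a ℝ).eval y := fun a => by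
      rw [aeval_def, eval₂_eq_eval_map, map_cyclotomic]
    rw [hfr, hQ, zero_mul, zero_add, map_sum, Finset.sum_div, Finset.sum_apply]
    refine Finset.sum_congr rfl fun a ha => ?_
    rw [Finset.sum_apply, map_mul, map_prod]
    simp only [hcyc]
    rw [← Finset.mul_prod_erase D _ ha, mul_div_mul_right _ _
      (Finset.prod_ne_zero_iff.2 fun b hb => hne b (Finset.mem_of_mem_erase hb))]
    have hdeg : (r a).natDegree < Nat.totient a := by
      have := hr a ha
      rw [degree_cyclotomic] at this
      by_cases h0 : r a = 0
      · simp [h0, hD a ha]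
      · exact (natDegree_lt_iff_degree_lt h0).2 this
    rw [aeval_eq_sum_range' hdeg, Finset.sum_div]
    refine Finset.sum_congr rfl fun b _ => ?_
    rw [Pi.smul_apply, letter_of_pos (hD a ha), Rat.smul_def, Rat.smul_def, mul_div_assoc]

open Polynomial in
/-- `y ^ j / (1 - y ^ s)` with `j < s` is a combination of letters other than `1 / y`. -/
lemma exists_letterSpan_eq_pow_div {s j : ℕ} (hj : j < s) :
    ∃ g ∈ letterSpan {(0, 0)}, ∀ y ∈ Ioo (0 : ℝ) 1, g y = y ^ j / (1 - y ^ s) := by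
  have hs : 0 < s := by omega
  have hprod := fun (R : Type) [CommRing R] => prod_cyclotomic_eq_X_pow_sub_one hs R
  obtain ⟨g, hg, hgy⟩ := exists_letterSpan_eq_div_prod (E := {(0, 0)}) s.divisors
    (fun a ha => Nat.pos_of_mem_divisors ha)
    (fun a ha b h => (Nat.pos_of_mem_divisors ha).ne' (by simpa using congrArg Prod.fst h))
    (-X ^ j : ℚ[X]) (by
      rw [hprod ℚ, degree_neg, degree_X_pow, ← C_1, degree_X_pow_sub_C hs]
      exact_mod_cast hj)
  refine ⟨g, hg, fun y hy => ?_⟩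
  rw [hgy y hy, ← eval_prod, hprod ℝ]
  simp only [map_neg, map_pow, aeval_X, eval_sub, eval_pow, eval_X, eval_one]
  rw [← neg_div_neg_eq, neg_neg, neg_sub]

open Polynomial in
/-- The pole at `1` cancels in `(y ^ i - y ^ j) / (1 - y ^ s)`. -/
lemma exists_letterSpan_eq_sub_div {s i j : ℕ} (hi : i < s) (hj : j < s) :
    ∃ g ∈ letterSpan {(0, 0), (1, 0)}, ∀ y ∈ Ioo (0 : ℝ) 1,
      g y = (y ^ i - y ^ j) / (1 - y ^ s) := by
  have hs : 0 < s := by omega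
  have h1 : 1 ∈ s.divisors := by simp; omega
  have hprod : ∀ (R : Type) [CommRing R], (X - 1) * ∏ a ∈ s.divisors.erase 1, cyclotomic a R
      = X ^ s - 1 := fun R _ => by
    rw [← prod_cyclotomic_eq_X_pow_sub_one hs R, ← Finset.mul_prod_erase _ _ h1, cyclotomic_one]
  obtain ⟨f, hf⟩ : (X - C 1 : ℚ[X]) ∣ X ^ j - X ^ i := dvd_iff_isRoot.2 (by simp)
  rw [C_1] at hf
  obtain ⟨g, hg, hgy⟩ := exists_letterSpan_eq_div_prod (E := {(0, 0), (1, 0)}) (s.divisors.erase 1)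
    (fun a ha => Nat.pos_of_mem_divisors (Finset.mem_of_mem_erase ha))
    (fun a ha b h => by
      have h0 := Nat.pos_of_mem_divisors (Finset.mem_of_mem_erase ha)
      have h2 := Finset.ne_of_mem_erase ha
      simp at h; omega)
    f (by
      by_cases hf0 : f = 0
      · rw [hf0, degree_zero, bot_lt_iff_ne_bot]
        exact degree_ne_bot.2 (monic_prod_of_monic _ _ fun a _ => cyclotomic.monic a ℚ).ne_zero
      have h2 : (X ^ j - X ^ i : ℚ[X]).degree < (X ^ s - 1 : ℚ[X]).degree := by
        rw [← C_1, degree_X_pow_sub_C hs]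
        refine (degree_sub_le _ _).trans_lt (max_lt ?_ ?_) <;> rw [degree_X_pow] <;> exact_mod_cast ‹_›
      rw [hf, ← hprod ℚ, degree_mul, degree_mul] at h2
      exact lt_of_add_lt_add_left h2)
  refine ⟨g, hg, fun y hy => ?_⟩
  have hy1 : y - 1 ≠ 0 := sub_ne_zero.2 hy.2.ne
  have e1 : (y - 1) * ∏ a ∈ s.divisors.erase 1, (cyclotomic a ℝ).eval y = y ^ s - 1 := by
    have := congrArg (eval y) (hprod ℝ)
    simpa [eval_prod] using this
  have e2 : y ^ j - y ^ i = (y - 1) * aeval y f := by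
    have := congrArg (aeval y) hf
    simpa using this
  rw [hgy y hy, ← mul_div_mul_left _ _ hy1, e1, ← e2, ← neg_div_neg_eq, neg_sub, neg_sub]

/-- The fractions `y ^ j / (y * (1 - y ^ s))` with `j ≤ s` are combinations of letters. The factor
`1 / y` shifts the exponent, so that `j = 0` is the one case that involves the letter `1 / y`. -/
lemma exists_letterSpan_eq {s j : ℕ} (hs : 0 < s) (hj : j ≤ s) :
    ∃ g ∈ letterSpan ∅, ∀ y ∈ Ioo (0 : ℝ) 1, g y = y ^ j / (y * (1 - y ^ s)) := by
  obtain ⟨t, rfl⟩ : ∃ t, s = t + 1 := ⟨s - 1, by omega⟩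
  rcases j with _ | j
  · obtain ⟨g, hg, hgy⟩ := exists_letterSpan_eq_pow_div (Nat.lt_add_one t)
    refine ⟨letter (0, 0) + g, add_mem (letter_mem_letterSpan (Or.inl rfl) (by simp))
      (letterSpan_anti (empty_subset _) hg), fun y hy => ?_⟩
    have h1 : 1 - y ^ (t + 1) ≠ 0 := by
      have := pow_lt_one₀ hy.1.le hy.2 t.add_one_ne_zero; linarith
    have h0 := hy.1.ne'
    rw [Pi.add_apply, hgy y hy, letter_zero]
    field_simp
    ring
  · obtain ⟨g, hg, hgy⟩ := exists_letterSpan_eq_pow_div (show j < t + 1 by omega)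
    refine ⟨g, letterSpan_anti (empty_subset _) hg, fun y hy => ?_⟩
    rw [hgy y hy, pow_succ' y j, mul_div_mul_left _ _ hy.1.ne']

lemma exists_letterSpan_eq_of_pos {s j : ℕ} (h1 : 1 ≤ j) (hj : j ≤ s) :
    ∃ g ∈ letterSpan {(0, 0)}, ∀ y ∈ Ioo (0 : ℝ) 1, g y = y ^ j / (y * (1 - y ^ s)) := by
  obtain ⟨j, rfl⟩ : ∃ i, j = i + 1 := ⟨j - 1, by omega⟩
  obtain ⟨g, hg, hgy⟩ := exists_letterSpan_eq_pow_div (show j < s by omega)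
  refine ⟨g, hg, fun y hy => ?_⟩
  rw [hgy y hy, pow_succ' y j, mul_div_mul_left _ _ hy.1.ne']

lemma exists_letterSpan_eq_sub_of_pos {s i j : ℕ} (h1 : 1 ≤ i) (hi : i ≤ s) (h2 : 1 ≤ j)
    (hj : j ≤ s) :
    ∃ g ∈ letterSpan {(0, 0), (1, 0)}, ∀ y ∈ Ioo (0 : ℝ) 1,
      g y = (y ^ i - y ^ j) / (y * (1 - y ^ s)) := by
  obtain ⟨i, rfl⟩ : ∃ l, i = l + 1 := ⟨i - 1, by omega⟩
  obtain ⟨j, rfl⟩ : ∃ l, j = l + 1 := ⟨j - 1, by omega⟩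
  obtain ⟨g, hg, hgy⟩ := exists_letterSpan_eq_sub_div (show i < s by omega) (show j < s by omega)
  refine ⟨g, hg, fun y hy => ?_⟩
  rw [hgy y hy, pow_succ' y i, pow_succ' y j, ← mul_sub, mul_div_mul_left _ _ hy.1.ne']

/-- If the exponent `i = 0` is allowed, only the pole at `1` is excluded. -/
lemma exists_letterSpan_eq_sub {s i j : ℕ} (hi : i ≤ s) (h2 : 1 ≤ j) (hj : j ≤ s) :
    ∃ g ∈ letterSpan {(1, 0)}, ∀ y ∈ Ioo (0 : ℝ) 1,
      g y = (y ^ i - y ^ j) / (y * (1 - y ^ s)) := by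
  have hmono : letterSpan {(0, 0), (1, 0)} ≤ letterSpan {(1, 0)} := letterSpan_anti (by simp)
  rcases Nat.eq_zero_or_pos i with rfl | h1
  · obtain ⟨g, hg, hgy⟩ := exists_letterSpan_eq_sub_of_pos (h2.trans hj) le_rfl h2 hj
    refine ⟨letter (0, 0) + g, add_mem (letter_mem_letterSpan (Or.inl rfl) (by simp)) (hmono hg),
      fun y hy => ?_⟩
    have h1 : 1 - y ^ s ≠ 0 := by
      have := pow_lt_one₀ hy.1.le hy.2 (show s ≠ 0 by omega); linarith
    have h0 := hy.1.ne'
    rw [Pi.add_apply, hgy y hy, letter_zero]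
    field_simp
    ring
  · obtain ⟨g, hg, hgy⟩ := exists_letterSpan_eq_sub_of_pos h1 hi h2 hj
    exact ⟨g, hmono hg, hgy⟩

/-! ### Size of the letters -/

lemma continuousAt_letter {m : ℕ × ℕ} (hm : IsLetter m) {x : ℝ} (hx : x ∈ Ioo (0 : ℝ) 1) :
    ContinuousAt (letter m) x := by
  obtain ⟨a, b⟩ := m
  rcases hm with h | h
  · rw [h, show letter (0, 0) = fun x => 1 / x from funext letter_zero]
    exact continuousAt_const.div continuousAt_id hx.1.ne'
  · have ha : 0 < a := Nat.totient_pos.1 (Nat.zero_lt_of_lt h)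
    rw [show letter (a, b) = fun x => x ^ b / (Polynomial.cyclotomic a ℝ).eval x from
      funext (letter_of_pos ha b)]
    exact (continuousAt_id.pow b).div (Polynomial.continuous _).continuousAt
      (cyclotomic_eval_ne_zero ha hx)

/-- Only `1 / x` is unbounded at `0`, and only `1 / (x - 1)` is unbounded at `1`. -/
lemma exists_abs_letter_le {m : ℕ × ℕ} (hm : IsLetter m) :
    ∃ C, 0 ≤ C ∧ ∀ x ∈ Ioo (0 : ℝ) 1, |letter m x| ≤ C / (x * (1 - x)) ∧
      (m ≠ (0, 0) → |letter m x| ≤ C / (1 - x)) ∧ (m ≠ (1, 0) → |letter m x| ≤ C / x) := by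
  obtain ⟨a, b⟩ := m
  have key : ∀ C : ℝ, 0 ≤ C → ∀ x ∈ Ioo (0 : ℝ) 1,
      C / x ≤ C / (x * (1 - x)) ∧ C / (1 - x) ≤ C / (x * (1 - x)) ∧ C ≤ C / x ∧ C ≤ C / (1 - x) := by
    intro C hC x ⟨h0, h1⟩
    have h2 : 0 < 1 - x := by linarith
    refine ⟨?_, ?_, ?_, ?_⟩
    · exact div_le_div_of_nonneg_left hC (mul_pos h0 h2) (by nlinarith)
    · exact div_le_div_of_nonneg_left hC (mul_pos h0 h2) (by nlinarith)
    · exact le_div_self hC h0 h1.le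
    · exact le_div_self hC h2 (by linarith)
  rcases hm with h | h
  · refine ⟨1, zero_le_one, fun x hx => ?_⟩
    have e : |letter (a, b) x| = 1 / x := by
      rw [h, letter_zero, abs_of_pos (one_div_pos.2 hx.1)]
    rw [e]
    exact ⟨(key 1 zero_le_one x hx).1, fun hne => absurd h hne, fun _ => le_rfl⟩
  · have ha : 0 < a := Nat.totient_pos.1 (Nat.zero_lt_of_lt h)
    rcases Nat.lt_or_ge a 2 with h2 | h2
    · obtain rfl : a = 1 := by omega
      obtain rfl : b = 0 := by simpa using h
      refine ⟨1, zero_le_one, fun x hx => ?_⟩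
      have e : |letter (1, 0) x| = 1 / (1 - x) := by
        rw [letter_of_pos one_pos, abs_div, Polynomial.cyclotomic_one]
        simp [abs_of_neg (sub_neg.2 hx.2)]
      rw [e]
      exact ⟨(key 1 zero_le_one x hx).2.1, fun _ => le_rfl, fun hne => absurd rfl hne⟩
    · have hc : ContinuousOn (letter (a, b)) (Icc 0 1) := by
        rw [show letter (a, b) = fun x => x ^ b / (Polynomial.cyclotomic a ℝ).eval x from
          funext (letter_of_pos ha b)]
        exact (continuousOn_id.pow b).div (Polynomial.continuous _).continuousOn
          fun x hx => (cyclotomic_eval_pos_of_two_le h2 hx.1).ne'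
      obtain ⟨C, hC⟩ := isCompact_Icc.exists_bound_of_continuousOn hc
      have hC0 : 0 ≤ C := (norm_nonneg _).trans (hC 0 (by simp))
      refine ⟨C, hC0, fun x hx => ?_⟩
      have hl : |letter (a, b) x| ≤ C := hC x ⟨hx.1.le, hx.2.le⟩
      obtain ⟨k1, -, k3, k4⟩ := key C hC0 x hx
      exact ⟨hl.trans (k3.trans k1), fun _ => hl.trans k4, fun _ => hl.trans k3⟩

/-- The part of a span of letters that excludes `1 / (x - 1)` is `O(1 / x)`. -/
lemma exists_abs_letterSpan_le {E : Set (ℕ × ℕ)} {g : ℝ → ℝ} (hg : g ∈ letterSpan E) :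
    ∃ C, 0 ≤ C ∧ ∀ x ∈ Ioo (0 : ℝ) 1, |g x| ≤ C / (x * (1 - x)) ∧
      ((1, 0) ∈ E → |g x| ≤ C / x) := by
  induction hg using Submodule.span_induction with
  | mem g hg =>
    obtain ⟨m, hm, hmE, rfl⟩ := hg
    obtain ⟨C, hC, h⟩ := exists_abs_letter_le hm
    exact ⟨C, hC, fun x hx => ⟨(h x hx).1, fun h1 => (h x hx).2.2 fun e => hmE (e ▸ h1)⟩⟩
  | zero => exact ⟨0, le_rfl, fun x _ => by simp⟩
  | add g h _ _ ihg ihh =>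
    obtain ⟨C, hC, h1⟩ := ihg
    obtain ⟨D, hD, h2⟩ := ihh
    refine ⟨C + D, add_nonneg hC hD, fun x hx => ⟨?_, fun hE => ?_⟩⟩
    · rw [add_div]
      exact (abs_add_le _ _).trans (add_le_add (h1 x hx).1 (h2 x hx).1)
    · rw [add_div]
      exact (abs_add_le _ _).trans (add_le_add ((h1 x hx).2 hE) ((h2 x hx).2 hE))
  | smul r g _ ih =>
    obtain ⟨C, hC, h1⟩ := ih
    refine ⟨|(r : ℝ)| * C, by positivity, fun x hx => ⟨?_, fun hE => ?_⟩⟩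
    · rw [Pi.smul_apply, Rat.smul_def, abs_mul, mul_div_assoc]
      exact mul_le_mul_of_nonneg_left (h1 x hx).1 (abs_nonneg _)
    · rw [Pi.smul_apply, Rat.smul_def, abs_mul, mul_div_assoc]
      exact mul_le_mul_of_nonneg_left ((h1 x hx).2 hE) (abs_nonneg _)

/-! ### Growth of iterated integrals -/

lemma hasDerivAt_div_one_sub_rpow (α : ℝ) {x : ℝ} (hx : x ∈ Ioo (0 : ℝ) 1) :
    HasDerivAt (fun x : ℝ => (x / (1 - x)) ^ α) (α / (x * (1 - x)) * (x / (1 - x)) ^ α) x := by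
  have h1 : 1 - x ≠ 0 := by linarith [hx.2]
  have h0 : x ≠ 0 := hx.1.ne'
  have hpos : 0 < x / (1 - x) := div_pos hx.1 (by linarith [hx.2])
  have hd : HasDerivAt (fun x : ℝ => x / (1 - x)) (1 / (1 - x) ^ 2) x := by
    convert! (hasDerivAt_id x).div ((hasDerivAt_const x (1 : ℝ)).sub (hasDerivAt_id x)) h1 using 1
    simp
  convert! hd.rpow_const (p := α) (Or.inl hpos.ne') using 1
  rw [Real.rpow_sub_one hpos.ne']
  field_simp

lemma continuousOn_div_one_sub_rpow {α : ℝ} (hα : 0 < α) {x : ℝ} (hx : x < 1) :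
    ContinuousOn (fun x : ℝ => (x / (1 - x)) ^ α) (Icc 0 x) := by
  refine ContinuousOn.rpow_const (continuousOn_id.div (by fun_prop) fun y hy => ?_)
    fun _ _ => Or.inr hα.le
  have := hy.2
  exact sub_ne_zero.2 (by linarith : (1 : ℝ) ≠ y)

/-- Integration from `0` preserves the growth `O((x / (1 - x)) ^ α)`, because `dx / (x (1 - x))` is
the logarithmic differential of `x / (1 - x)`. -/
lemma integral_zero_of_abs_le {g : ℝ → ℝ} {C α : ℝ} (hα : 0 < α)
    (hg : ∀ x ∈ Ioo (0 : ℝ) 1, ContinuousAt g x)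
    (hC : ∀ x ∈ Ioo (0 : ℝ) 1, |g x| ≤ C / (x * (1 - x)) * (x / (1 - x)) ^ α)
    {x : ℝ} (hx : x ∈ Ioo (0 : ℝ) 1) :
    HasDerivAt (fun x => ∫ y in (0 : ℝ)..x, g y) (g x) x ∧
      |∫ y in (0 : ℝ)..x, g y| ≤ C / α * (x / (1 - x)) ^ α := by
  have hsub : ∀ z ∈ Ioo (0 : ℝ) x, z ∈ Ioo (0 : ℝ) 1 := fun z hz => ⟨hz.1, hz.2.trans hx.2⟩
  have hcont := continuousOn_div_one_sub_rpow hα hx.2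
  have hint0 : IntervalIntegrable (fun z => α / (z * (1 - z)) * (z / (1 - z)) ^ α)
      MeasureTheory.volume 0 x := by
    rw [intervalIntegrable_iff_integrableOn_Ioc_of_le hx.1.le]
    refine intervalIntegral.integrableOn_deriv_of_nonneg hcont
      (fun z hz => hasDerivAt_div_one_sub_rpow α (hsub z hz)) fun z hz => ?_
    have h1 := (hsub z hz).1
    have h2 : 0 < 1 - z := by linarith [(hsub z hz).2]
    positivity
  have heq : (fun z => C / (z * (1 - z)) * (z / (1 - z)) ^ α)
      = fun z => C / α * (α / (z * (1 - z)) * (z / (1 - z)) ^ α) := by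
    funext z; field_simp
  have hint1 : IntervalIntegrable (fun z => C / (z * (1 - z)) * (z / (1 - z)) ^ α)
      MeasureTheory.volume 0 x := by
    rw [heq]; exact hint0.const_mul _
  have hcg : ContinuousOn g (Ioo 0 1) := fun z hz => (hg z hz).continuousWithinAt
  have hmeas : MeasureTheory.AEStronglyMeasurable g
      (MeasureTheory.volume.restrict (Ioc 0 x)) :=
    (hcg.mono fun z hz => ⟨hz.1, hz.2.trans_lt hx.2⟩).aestronglyMeasurable measurableSet_Ioc
  have hae : ∀ᵐ z ∂(MeasureTheory.volume.restrict (Ioc 0 x)),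
      ‖g z‖ ≤ C / (z * (1 - z)) * (z / (1 - z)) ^ α := by
    rw [MeasureTheory.ae_restrict_iff' measurableSet_Ioc]
    exact Eventually.of_forall fun z hz => hC z ⟨hz.1, hz.2.trans_lt hx.2⟩
  have hint : IntervalIntegrable g MeasureTheory.volume 0 x := by
    rw [intervalIntegrable_iff_integrableOn_Ioc_of_le hx.1.le] at hint1 ⊢
    exact MeasureTheory.Integrable.mono' hint1 hmeas hae
  refine ⟨intervalIntegral.integral_hasDerivAt_right hint
    (hcg.stronglyMeasurableAtFilter isOpen_Ioo x hx) (hg x hx), ?_⟩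
  refine (intervalIntegral.norm_integral_le_of_norm_le hx.1.le
    ((MeasureTheory.ae_restrict_iff' measurableSet_Ioc).1 hae) hint1).trans ?_
  rw [heq, intervalIntegral.integral_const_mul, intervalIntegral.integral_eq_sub_of_hasDerivAt_of_le
    hx.1.le hcont (fun z hz => hasDerivAt_div_one_sub_rpow α (hsub z hz)) hint0]
  simp [Real.zero_rpow hα.ne']

/-- Words of letters whose last letter is not `(0, 0)`. For these the defining integral is used at
every step of the recursion for `cyclotomicPolylog`. -/
inductive IsIntegralWord : List (ℕ × ℕ) → Prop
  | singleton {m : ℕ × ℕ} : IsLetter m → m ≠ (0, 0) → IsIntegralWord [m]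
  | cons {m : ℕ × ℕ} {w : List (ℕ × ℕ)} : IsLetter m → IsIntegralWord w → IsIntegralWord (m :: w)

lemma IsIntegralWord.exists_ne {w : List (ℕ × ℕ)} (hw : IsIntegralWord w) :
    ∃ l ∈ w, l ≠ (0, 0) := by
  induction hw with
  | singleton _ h => exact ⟨_, by simp, h⟩
  | cons _ _ ih => obtain ⟨l, hl, h⟩ := ih; exact ⟨l, by simp [hl], h⟩

lemma IsIntegralWord.isLetter {w : List (ℕ × ℕ)} (hw : IsIntegralWord w) :
    ∀ m ∈ w, IsLetter m := by
  induction hw with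
  | singleton h _ => simpa using h
  | cons h _ ih => simpa using ⟨h, fun a b => ih (a, b)⟩

lemma cyclotomicPolylog_cons {m : ℕ × ℕ} {w : List (ℕ × ℕ)} (hw : IsIntegralWord (m :: w)) :
    cyclotomicPolylog (m :: w) = fun x => ∫ y in (0 : ℝ)..x, letter m y * cyclotomicPolylog w y := by
  funext x
  rw [cyclotomicPolylog, if_neg]
  obtain ⟨l, hl, h⟩ := hw.exists_ne
  exact fun hall => h (hall l hl)

/-- The derivative and the growth of the polylogarithm of a word that ends in a letter other than
`(0, 0)`. -/
lemma IsIntegralWord.growth {w : List (ℕ × ℕ)} (hw : IsIntegralWord w) {α : ℝ}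
    (hα : α ∈ Ioo (0 : ℝ) 1) :
    ∃ C, 0 ≤ C ∧ ∀ x ∈ Ioo (0 : ℝ) 1,
      HasDerivAt (cyclotomicPolylog w)
        (letter (w.headI) x * cyclotomicPolylog w.tail x) x ∧
      |cyclotomicPolylog w x| ≤ C * (x / (1 - x)) ^ α := by
  induction hw with
  | @singleton m hm h0 =>
    obtain ⟨C, hC, hb⟩ := exists_abs_letter_le hm
    refine ⟨C / α, div_nonneg hC hα.1.le, fun x hx => ?_⟩
    rw [cyclotomicPolylog_cons (.singleton hm h0)]
    refine integral_zero_of_abs_le (g := fun y => letter m y * cyclotomicPolylog [] y) hα.1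
      (fun y hy => ?_) (fun y hy => ?_) hx
    · simpa [cyclotomicPolylog] using continuousAt_letter hm hy
    · have h1 : 0 < 1 - y := by linarith [hy.2]
      have h2 := hy.1
      simp only [cyclotomicPolylog, mul_one]
      refine ((hb y hy).2.1 h0).trans ?_
      have h3 : y ≤ (y / (1 - y)) ^ α := by
        calc y ≤ y ^ α := Real.self_le_rpow_of_le_one hy.1.le hy.2.le hα.2.le
          _ ≤ (y / (1 - y)) ^ α := by
            refine Real.rpow_le_rpow hy.1.le (le_div_self hy.1.le h1 (by linarith)) hα.1.le
      calc C / (1 - y) = C / (y * (1 - y)) * y := by field_simp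
        _ ≤ _ := mul_le_mul_of_nonneg_left h3 (by positivity)
  | @cons m w hm hw ih =>
    obtain ⟨D, hD, ih⟩ := ih
    obtain ⟨C, hC, hb⟩ := exists_abs_letter_le hm
    refine ⟨C * D / α, div_nonneg (mul_nonneg hC hD) hα.1.le, fun x hx => ?_⟩
    rw [cyclotomicPolylog_cons (.cons hm hw)]
    refine integral_zero_of_abs_le (g := fun y => letter m y * cyclotomicPolylog w y) hα.1
      (fun y hy => ?_) (fun y hy => ?_) hx
    · exact (continuousAt_letter hm hy).mul (ih y hy).1.continuousAt
    · have h1 : 0 < 1 - y := by linarith [hy.2]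
      have h2 := hy.1
      rw [abs_mul]
      calc |letter m y| * |cyclotomicPolylog w y|
          ≤ C / (y * (1 - y)) * (D * (y / (1 - y)) ^ α) :=
            mul_le_mul (hb y hy).1 (ih y hy).2 (abs_nonneg _) (by positivity)
        _ = _ := by ring

lemma IsIntegralWord.tail {w : List (ℕ × ℕ)} (hw : IsIntegralWord w) :
    w.tail = [] ∧ w.headI ≠ (0, 0) ∨ IsIntegralWord w.tail := by
  cases hw with
  | singleton _ h => exact Or.inl ⟨rfl, h⟩
  | cons _ h => exact Or.inr h

/-- If moreover the first letter is not `(1, 0)`, the polylogarithm has a limit at one. -/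
lemma IsIntegralWord.exists_tendsto {w : List (ℕ × ℕ)} (hw : IsIntegralWord w)
    (h1 : w.headI ≠ (1, 0)) :
    ∃ v ∈ cyclotomicPolylogsAtOne, Tendsto (cyclotomicPolylog w) (𝓝[<] (1 : ℝ)) (𝓝 v) := by
  suffices h : ∃ v, Tendsto (cyclotomicPolylog w) (𝓝[<] (1 : ℝ)) (𝓝 v) by
    obtain ⟨v, hv⟩ := h
    exact ⟨v, ⟨w, hw.isLetter, hv⟩, hv⟩
  obtain ⟨K, hK, hgr⟩ := hw.growth (α := 1 / 2) (by norm_num)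
  have hm : IsLetter w.headI := hw.isLetter _ (by cases hw <;> simp)
  -- the integrand is dominated by `y ^ (-1/2) * (1 - y) ^ (-1/2)` up to a factor
  have hdom : ∃ C, 0 ≤ C ∧ ∀ y ∈ Ioo (0 : ℝ) 1,
      |letter w.headI y * cyclotomicPolylog w.tail y|
        ≤ C * (y ^ (-(1 / 2) : ℝ) + (1 - y) ^ (-(1 / 2) : ℝ)) := by
    obtain ⟨C, hC, hb⟩ := exists_abs_letter_le hm
    have hone : ∀ z ∈ Ioo (0 : ℝ) 1, 1 ≤ z ^ (-(1 / 2) : ℝ) := fun z hz =>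
      Real.one_le_rpow_of_pos_of_le_one_of_nonpos hz.1 hz.2.le (by norm_num)
    rcases hw.tail with ⟨ht, h0⟩ | ht
    · refine ⟨2 * C, by positivity, fun y hy => ?_⟩
      have hy' : 1 - y ∈ Ioo (0 : ℝ) 1 := ⟨by linarith [hy.2], by linarith [hy.1]⟩
      have hl : |letter w.headI y| ≤ 2 * C := by
        rcases le_total y (1 / 2) with h | h
        · refine ((hb y hy).2.1 h0).trans ?_
          rw [div_le_iff₀ hy'.1]; nlinarith
        · refine ((hb y hy).2.2 h1).trans ?_
          rw [div_le_iff₀ hy.1]; nlinarith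
      rw [ht, cyclotomicPolylog, mul_one]
      refine hl.trans (le_mul_of_one_le_right (by positivity) ?_)
      linarith [hone y hy, hone _ hy']
    · obtain ⟨D, hD, hd⟩ := ht.growth (α := 1 / 2) (by norm_num)
      refine ⟨C * D * 2, by positivity, fun y hy => ?_⟩
      have hy' : 1 - y ∈ Ioo (0 : ℝ) 1 := ⟨by linarith [hy.2], by linarith [hy.1]⟩
      have hprod : y ^ (-(1 / 2) : ℝ) * (1 - y) ^ (-(1 / 2) : ℝ)
          ≤ 2 * (y ^ (-(1 / 2) : ℝ) + (1 - y) ^ (-(1 / 2) : ℝ)) := by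
        have hhalf : ∀ z : ℝ, 1 / 2 ≤ z → z ^ (-(1 / 2) : ℝ) ≤ 2 := by
          intro z hz
          calc z ^ (-(1 / 2) : ℝ) ≤ (1 / 2 : ℝ) ^ (-(1 / 2) : ℝ) :=
                Real.rpow_le_rpow_of_nonpos (by norm_num) hz (by norm_num)
            _ ≤ (1 / 2 : ℝ) ^ (-1 : ℝ) :=
                Real.rpow_le_rpow_of_exponent_ge (by norm_num) (by norm_num) (by norm_num)
            _ = 2 := by rw [Real.rpow_neg_one]; norm_num
        have p1 : 0 ≤ y ^ (-(1 / 2) : ℝ) := Real.rpow_nonneg hy.1.le _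
        have p2 : 0 ≤ (1 - y) ^ (-(1 / 2) : ℝ) := Real.rpow_nonneg hy'.1.le _
        rcases le_total y (1 / 2) with h | h
        · have := hhalf (1 - y) (by linarith); nlinarith
        · have := hhalf y h; nlinarith
      rw [abs_mul]
      calc |letter w.headI y| * |cyclotomicPolylog w.tail y|
          ≤ C / y * (D * (y / (1 - y)) ^ (1 / 2 : ℝ)) :=
            mul_le_mul ((hb y hy).2.2 h1) (hd y hy).2 (abs_nonneg _) (div_nonneg hC hy.1.le)
        _ = C * D * (y ^ (-(1 / 2) : ℝ) * (1 - y) ^ (-(1 / 2) : ℝ)) := by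
            have e : y ^ (-(1 / 2) : ℝ) = y ^ (1 / 2 : ℝ) / y := by
              rw [← Real.rpow_sub_one hy.1.ne']; norm_num
            rw [e, Real.div_rpow hy.1.le hy'.1.le, Real.rpow_neg hy'.1.le]
            field_simp
        _ ≤ _ := by
            rw [mul_assoc (C * D)]
            exact mul_le_mul_of_nonneg_left hprod (by positivity)
  obtain ⟨C, hC, hdom⟩ := hdom
  set g : ℝ → ℝ := fun y => letter w.headI y * cyclotomicPolylog w.tail y with hg
  have hcg : ContinuousOn g (Ioo 0 1) := by
    intro y hy
    refine ((continuousAt_letter hm hy).mul ?_).continuousWithinAt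
    rcases hw.tail with ⟨ht, -⟩ | ht
    · rw [ht]; exact continuousAt_const
    · obtain ⟨D, hD, hd⟩ := ht.growth (α := 1 / 2) (by norm_num)
      exact (hd y hy).1.continuousAt
  have hint : MeasureTheory.IntegrableOn g (Ioo 0 1) := by
    have i1 : IntervalIntegrable (fun y : ℝ => y ^ (-(1 / 2) : ℝ)) MeasureTheory.volume 0 1 :=
      intervalIntegral.intervalIntegrable_rpow' (by norm_num)
    have i2 : IntervalIntegrable (fun y : ℝ => (1 - y) ^ (-(1 / 2) : ℝ)) MeasureTheory.volume 0 1 := by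
      have := i1.comp_sub_left 1
      simpa using this.symm
    have i3 := (i1.add i2).const_mul C
    rw [intervalIntegrable_iff_integrableOn_Ioo_of_le zero_le_one] at i3
    refine MeasureTheory.Integrable.mono' i3 (hcg.aestronglyMeasurable measurableSet_Ioo) ?_
    rw [MeasureTheory.ae_restrict_iff' measurableSet_Ioo]
    exact Eventually.of_forall fun y hy => hdom y hy
  have hcont := intervalIntegral.continuousOn_primitive_interval
    (μ := MeasureTheory.volume) (a := 0) (b := 1) (f := g) (by
      rw [uIcc_of_le zero_le_one, integrableOn_Icc_iff_integrableOn_Ioo]; exact hint)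
  rw [uIcc_of_le zero_le_one] at hcont
  refine ⟨∫ y in (0 : ℝ)..1, g y, ?_⟩
  have hlim : Tendsto (fun x => ∫ y in (0 : ℝ)..x, g y) (𝓝[<] (1 : ℝ)) (𝓝 (∫ y in (0 : ℝ)..1, g y)) := by
    have := hcont 1 (by simp)
    refine Tendsto.mono_left this ?_
    rw [← nhdsWithin_Ioo_eq_nhdsLT (zero_lt_one' ℝ)]
    exact nhdsWithin_mono _ Ioo_subset_Icc_self
  have he : cyclotomicPolylog w = fun x => ∫ y in (0 : ℝ)..x, g y := by
    cases hw with
    | singleton hm h0 => exact cyclotomicPolylog_cons (.singleton hm h0)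
    | cons hm hw => exact cyclotomicPolylog_cons (.cons hm hw)
  rw [he]
  exact hlim

/-! ### Spans of polylogarithms -/

/-- The rational span of the polylogarithms of integral words whose first letter is not in `E`. -/
noncomputable def polylogSpan (E : Set (ℕ × ℕ)) : Submodule ℚ (ℝ → ℝ) :=
  Submodule.span ℚ {h | ∃ w, IsIntegralWord w ∧ w.headI ∉ E ∧ h = cyclotomicPolylog w}

lemma polylogSpan_anti {E F : Set (ℕ × ℕ)} (h : E ⊆ F) : polylogSpan F ≤ polylogSpan E :=
  Submodule.span_mono fun _ ⟨w, h1, h2, h3⟩ => ⟨w, h1, fun hm => h2 (h hm), h3⟩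

/-- The algebra generated by the cyclotomic polylogarithms at one. -/
noncomputable abbrev polylogAlgebra : Subalgebra ℚ ℝ := Algebra.adjoin ℚ cyclotomicPolylogsAtOne

lemma exists_abs_polylogSpan_le {E : Set (ℕ × ℕ)} {h : ℝ → ℝ} (hh : h ∈ polylogSpan E) {α : ℝ}
    (hα : α ∈ Ioo (0 : ℝ) 1) :
    ∃ C, 0 ≤ C ∧ ∀ x ∈ Ioo (0 : ℝ) 1, DifferentiableAt ℝ h x ∧ |h x| ≤ C * (x / (1 - x)) ^ α := by
  induction hh using Submodule.span_induction with
  | mem h hh =>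
    obtain ⟨w, hw, -, rfl⟩ := hh
    obtain ⟨C, hC, hd⟩ := hw.growth hα
    exact ⟨C, hC, fun x hx => ⟨(hd x hx).1.differentiableAt, (hd x hx).2⟩⟩
  | zero => exact ⟨0, le_rfl, fun x _ => ⟨differentiableAt_const 0, by simp⟩⟩
  | add g h _ _ ihg ihh =>
    obtain ⟨C, hC, h1⟩ := ihg
    obtain ⟨D, hD, h2⟩ := ihh
    refine ⟨C + D, add_nonneg hC hD, fun x hx => ⟨(h1 x hx).1.add (h2 x hx).1, ?_⟩⟩
    rw [add_mul]
    exact (abs_add_le _ _).trans (add_le_add (h1 x hx).2 (h2 x hx).2)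
  | smul r g _ ih =>
    obtain ⟨C, hC, h1⟩ := ih
    refine ⟨|(r : ℝ)| * C, by positivity, fun x hx => ⟨(h1 x hx).1.const_smul r, ?_⟩⟩
    rw [Pi.smul_apply, Rat.smul_def, abs_mul, mul_assoc]
    exact mul_le_mul_of_nonneg_left (h1 x hx).2 (abs_nonneg _)

lemma tendsto_div_one_sub_rpow {α : ℝ} (hα : 0 < α) :
    Tendsto (fun x : ℝ => (x / (1 - x)) ^ α) (𝓝[>] 0) (𝓝 0) := by
  have h : ContinuousAt (fun x : ℝ => (x / (1 - x)) ^ α) 0 :=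
    (continuousAt_id.div (by fun_prop) (by simp)).rpow_const (Or.inr hα.le)
  have := h.tendsto
  simp only [zero_div, Real.zero_rpow hα.ne'] at this
  exact this.mono_left nhdsWithin_le_nhds

lemma tendsto_one_sub_div_rpow {α : ℝ} (hα : 0 < α) :
    Tendsto (fun x : ℝ => ((1 - x) / x) ^ α) (𝓝[<] 1) (𝓝 0) := by
  have h : ContinuousAt (fun x : ℝ => ((1 - x) / x) ^ α) 1 :=
    (ContinuousAt.div (by fun_prop) continuousAt_id (by simp)).rpow_const (Or.inr hα.le)
  have := h.tendsto
  simp only [sub_self, zero_div, Real.zero_rpow hα.ne'] at this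
  exact this.mono_left nhdsWithin_le_nhds

lemma eventually_nhdsGT_zero_mem_Ioo : ∀ᶠ x in 𝓝[>] (0 : ℝ), x ∈ Ioo (0 : ℝ) 1 :=
  Ioo_mem_nhdsGT zero_lt_one

lemma eventually_nhdsLT_one_mem_Ioo : ∀ᶠ x in 𝓝[<] (1 : ℝ), x ∈ Ioo (0 : ℝ) 1 :=
  Ioo_mem_nhdsLT zero_lt_one

lemma tendsto_zero_of_mem_polylogSpan {E : Set (ℕ × ℕ)} {h : ℝ → ℝ} (hh : h ∈ polylogSpan E) :
    Tendsto h (𝓝[>] 0) (𝓝 0) := by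
  obtain ⟨C, hC, hb⟩ := exists_abs_polylogSpan_le hh (α := 1 / 2) (by norm_num)
  have ht := (tendsto_div_one_sub_rpow (α := 1 / 2) (by norm_num)).const_mul C
  rw [mul_zero] at ht
  refine squeeze_zero_norm' ?_ ht
  filter_upwards [eventually_nhdsGT_zero_mem_Ioo] with x hx using (hb x hx).2

lemma exists_tendsto_of_mem_polylogSpan {h : ℝ → ℝ} (hh : h ∈ polylogSpan {(1, 0)}) :
    ∃ L ∈ polylogAlgebra, Tendsto h (𝓝[<] 1) (𝓝 L) := by
  induction hh using Submodule.span_induction with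
  | mem h hh =>
    obtain ⟨w, hw, h1, rfl⟩ := hh
    obtain ⟨v, hv, ht⟩ := hw.exists_tendsto h1
    exact ⟨v, Algebra.subset_adjoin hv, ht⟩
  | zero => exact ⟨0, zero_mem _, tendsto_const_nhds⟩
  | add g h _ _ ihg ihh =>
    obtain ⟨L, hL, h1⟩ := ihg
    obtain ⟨K, hK, h2⟩ := ihh
    exact ⟨L + K, add_mem hL hK, h1.add h2⟩
  | smul r g _ ih =>
    obtain ⟨L, hL, h1⟩ := ih
    exact ⟨r • L, Subalgebra.smul_mem _ hL r, h1.const_smul r⟩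

/-- Prefixing a combination of letters to a combination of words. -/
lemma exists_polylogSpan_hasDerivAt_mul {E : Set (ℕ × ℕ)} {g h : ℝ → ℝ} (hg : g ∈ letterSpan E)
    (hh : h ∈ polylogSpan ∅) :
    ∃ k ∈ polylogSpan E, ∀ x ∈ Ioo (0 : ℝ) 1, HasDerivAt k (g x * h x) x := by
  induction hh using Submodule.span_induction with
  | mem h hh =>
    obtain ⟨w, hw, -, rfl⟩ := hh
    induction hg using Submodule.span_induction with
    | mem g hg =>
      obtain ⟨m, hm, hE, rfl⟩ := hg
      obtain ⟨C, -, hd⟩ := (IsIntegralWord.cons hm hw).growth (α := 1 / 2) (by norm_num)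
      exact ⟨_, Submodule.subset_span ⟨m :: w, .cons hm hw, hE, rfl⟩, fun x hx => (hd x hx).1⟩
    | zero => exact ⟨0, zero_mem _, fun x _ => by simp⟩
    | add f g _ _ ihf ihg =>
      obtain ⟨k, hk, h1⟩ := ihf
      obtain ⟨l, hl, h2⟩ := ihg
      refine ⟨k + l, add_mem hk hl, fun x hx => ?_⟩
      rw [Pi.add_apply, add_mul]
      exact (h1 x hx).add (h2 x hx)
    | smul r g _ ih =>
      obtain ⟨k, hk, h1⟩ := ih
      refine ⟨r • k, Submodule.smul_mem _ _ hk, fun x hx => ?_⟩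
      rw [Pi.smul_apply, smul_mul_assoc]
      exact (h1 x hx).const_smul r
  | zero => exact ⟨0, zero_mem _, fun x _ => by simp⟩
  | add f h _ _ ihf ihh =>
    obtain ⟨k, hk, h1⟩ := ihf
    obtain ⟨l, hl, h2⟩ := ihh
    refine ⟨k + l, add_mem hk hl, fun x hx => ?_⟩
    rw [Pi.add_apply, mul_add]
    exact (h1 x hx).add (h2 x hx)
  | smul r h _ ih =>
    obtain ⟨k, hk, h1⟩ := ih
    refine ⟨r • k, Submodule.smul_mem _ _ hk, fun x hx => ?_⟩
    rw [Pi.smul_apply, mul_smul_comm]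
    exact (h1 x hx).const_smul r

lemma exists_polylogSpan_hasDerivAt {E : Set (ℕ × ℕ)} (hE : (0, 0) ∈ E) {g : ℝ → ℝ}
    (hg : g ∈ letterSpan E) :
    ∃ k ∈ polylogSpan E, ∀ x ∈ Ioo (0 : ℝ) 1, HasDerivAt k (g x) x := by
  induction hg using Submodule.span_induction with
  | mem g hg =>
    obtain ⟨m, hm, hmE, rfl⟩ := hg
    have h0 : m ≠ (0, 0) := fun h => hmE (h ▸ hE)
    obtain ⟨C, -, hd⟩ := (IsIntegralWord.singleton hm h0).growth (α := 1 / 2) (by norm_num)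
    exact ⟨_, Submodule.subset_span ⟨[m], .singleton hm h0, hmE, rfl⟩,
      fun x hx => by simpa [cyclotomicPolylog] using (hd x hx).1⟩
  | zero => exact ⟨0, zero_mem _, fun x _ => by simp⟩
  | add f g _ _ ihf ihg =>
    obtain ⟨k, hk, h1⟩ := ihf
    obtain ⟨l, hl, h2⟩ := ihg
    exact ⟨k + l, add_mem hk hl, fun x hx => (h1 x hx).add (h2 x hx)⟩
  | smul r g _ ih =>
    obtain ⟨k, hk, h1⟩ := ih
    exact ⟨r • k, Submodule.smul_mem _ _ hk, fun x hx => (h1 x hx).const_smul r⟩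

/-! ### Iterated integrals taken from the other endpoint -/

/-- Functions on the unit interval obtained by iterated integration from `1`, instead of from `0`,
over rational combinations of letters; the innermost combination has no pole at `1`. The iterated
integral is recorded by its derivative and its limit at `1`. -/
inductive IsDualPolylog : (ℝ → ℝ) → Prop
  | base {B g : ℝ → ℝ} : g ∈ letterSpan {(1, 0)} →
      (∀ y ∈ Ioo (0 : ℝ) 1, HasDerivAt B (-g y) y) → Tendsto B (𝓝[<] 1) (𝓝 0) → IsDualPolylog B
  | step {A B g : ℝ → ℝ} : g ∈ letterSpan ∅ → IsDualPolylog A →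
      (∀ y ∈ Ioo (0 : ℝ) 1, HasDerivAt B (-(g y * A y)) y) → Tendsto B (𝓝[<] 1) (𝓝 0) →
      IsDualPolylog B

lemma hasDerivAt_one_sub_div_rpow (β : ℝ) {y : ℝ} (hy : y ∈ Ioo (0 : ℝ) 1) :
    HasDerivAt (fun y : ℝ => ((1 - y) / y) ^ β)
      (-(β / (y * (1 - y)) * ((1 - y) / y) ^ β)) y := by
  have hy' : 1 - y ∈ Ioo (0 : ℝ) 1 := ⟨by linarith [hy.2], by linarith [hy.1]⟩
  have h := (hasDerivAt_div_one_sub_rpow β hy').comp y ((hasDerivAt_id y).const_sub 1)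
  simp only [Function.comp_def, sub_sub_cancel] at h
  convert! h using 1
  ring

/-- Comparison with `((1 - y) / y) ^ β` for a function that vanishes at `1`. -/
lemma abs_le_of_hasDerivAt_of_tendsto {B b : ℝ → ℝ} {C β : ℝ} (hβ : 0 < β)
    (hB : ∀ y ∈ Ioo (0 : ℝ) 1, HasDerivAt B (b y) y) (h1 : Tendsto B (𝓝[<] 1) (𝓝 0))
    (hb : ∀ y ∈ Ioo (0 : ℝ) 1, |b y| ≤ C / (y * (1 - y)) * ((1 - y) / y) ^ β)
    {y : ℝ} (hy : y ∈ Ioo (0 : ℝ) 1) : |B y| ≤ C / β * ((1 - y) / y) ^ β := by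
  have key : ∀ F f : ℝ → ℝ, (∀ y ∈ Ioo (0 : ℝ) 1, HasDerivAt F (f y) y) →
      Tendsto F (𝓝[<] 1) (𝓝 0) →
      (∀ y ∈ Ioo (0 : ℝ) 1, |f y| ≤ C / (y * (1 - y)) * ((1 - y) / y) ^ β) →
      F y ≤ C / β * ((1 - y) / y) ^ β := by
    intro F f hF hF1 hf
    have hd : ∀ z ∈ Ioo (0 : ℝ) 1, HasDerivAt (fun z => C / β * ((1 - z) / z) ^ β - F z)
        (C / β * -(β / (z * (1 - z)) * ((1 - z) / z) ^ β) - f z) z := fun z hz =>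
      ((hasDerivAt_one_sub_div_rpow β hz).const_mul _).sub (hF z hz)
    have hanti : AntitoneOn (fun z => C / β * ((1 - z) / z) ^ β - F z) (Ioo 0 1) := by
      refine antitoneOn_of_deriv_nonpos (convex_Ioo 0 1)
        (fun z hz => (hd z hz).continuousAt.continuousWithinAt) ?_ ?_
      · rw [interior_Ioo]
        exact fun z hz => (hd z hz).differentiableAt.differentiableWithinAt
      · rw [interior_Ioo]
        intro z hz
        rw [(hd z hz).deriv]
        have e : C / β * -(β / (z * (1 - z)) * ((1 - z) / z) ^ β)
            = -(C / (z * (1 - z)) * ((1 - z) / z) ^ β) := by field_simp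
        rw [e]
        linarith [neg_abs_le (f z), hf z hz]
    have hlim : Tendsto (fun z => C / β * ((1 - z) / z) ^ β - F z) (𝓝[<] 1) (𝓝 0) := by
      simpa using ((tendsto_one_sub_div_rpow hβ).const_mul (C / β)).sub hF1
    have : 0 ≤ C / β * ((1 - y) / y) ^ β - F y := by
      refine le_of_tendsto hlim ?_
      filter_upwards [Ioo_mem_nhdsLT hy.2] with z hz
      exact hanti hy ⟨hy.1.trans hz.1, hz.2⟩ hz.1.le
    linarith
  refine abs_le'.2 ⟨key B b hB h1 hb, key (fun z => -B z) (fun z => -b z)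
    (fun z hz => (hB z hz).neg) (by simpa using h1.neg) fun z hz => ?_⟩
  rw [abs_neg]
  exact hb z hz

lemma IsDualPolylog.growth {B : ℝ → ℝ} (hB : IsDualPolylog B) {β : ℝ} (hβ : β ∈ Ioo (0 : ℝ) 1) :
    ∃ C, 0 ≤ C ∧ ∀ y ∈ Ioo (0 : ℝ) 1, |B y| ≤ C * ((1 - y) / y) ^ β := by
  induction hB with
  | @base B g hg hd h1 =>
    obtain ⟨C, hC, hb⟩ := exists_abs_letterSpan_le hg
    refine ⟨C / β, div_nonneg hC hβ.1.le, fun y hy =>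
      abs_le_of_hasDerivAt_of_tendsto hβ.1 hd h1 (fun z hz => ?_) hy⟩
    have h2 : 0 < 1 - z := by linarith [hz.2]
    have h0 := hz.1
    rw [abs_neg]
    refine ((hb z hz).2 rfl).trans ?_
    have h3 : 1 - z ≤ ((1 - z) / z) ^ β := by
      calc 1 - z ≤ (1 - z) ^ β := Real.self_le_rpow_of_le_one h2.le (by linarith) hβ.2.le
        _ ≤ ((1 - z) / z) ^ β :=
          Real.rpow_le_rpow h2.le (le_div_self h2.le h0 hz.2.le) hβ.1.le
    calc C / z = C / (z * (1 - z)) * (1 - z) := by field_simp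
      _ ≤ _ := mul_le_mul_of_nonneg_left h3 (by positivity)
  | @step A B g hg hA hd h1 ih =>
    obtain ⟨C, hC, hb⟩ := exists_abs_letterSpan_le hg
    obtain ⟨D, hD, hAb⟩ := ih
    refine ⟨C * D / β, div_nonneg (mul_nonneg hC hD) hβ.1.le, fun y hy =>
      abs_le_of_hasDerivAt_of_tendsto hβ.1 hd h1 (fun z hz => ?_) hy⟩
    have h2 : 0 < 1 - z := by linarith [hz.2]
    have h0 := hz.1
    rw [abs_neg, abs_mul]
    calc |g z| * |A z| ≤ C / (z * (1 - z)) * (D * ((1 - z) / z) ^ β) :=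
          mul_le_mul (hb z hz).1 (hAb z hz) (abs_nonneg _) (by positivity)
      _ = _ := by ring

/-- The product of a polylogarithm and a dual one vanishes at both ends: each function is smaller
at one end than every power by which the other one may grow there. -/
lemma tendsto_mul_of_isDualPolylog {h B : ℝ → ℝ} (hh : h ∈ polylogSpan ∅) (hB : IsDualPolylog B) :
    Tendsto (fun x => h x * B x) (𝓝[>] 0) (𝓝 0) ∧ Tendsto (fun x => h x * B x) (𝓝[<] 1) (𝓝 0) := by
  have hinv : ∀ x ∈ Ioo (0 : ℝ) 1, ∀ β : ℝ,
      ((1 - x) / x) ^ β = ((x / (1 - x)) ^ β)⁻¹ := fun x hx β => by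
    rw [← Real.inv_rpow (div_nonneg hx.1.le (by linarith [hx.2])), inv_div]
  have hpos : ∀ x ∈ Ioo (0 : ℝ) 1, 0 < x / (1 - x) := fun x hx =>
    div_pos hx.1 (by linarith [hx.2])
  constructor
  · obtain ⟨C, hC, hb⟩ := exists_abs_polylogSpan_le hh (α := 1 / 2) (by norm_num)
    obtain ⟨D, hD, hd⟩ := hB.growth (β := 1 / 4) (by norm_num)
    have ht := (tendsto_div_one_sub_rpow (α := 1 / 4) (by norm_num)).const_mul (C * D)
    rw [mul_zero] at ht
    refine squeeze_zero_norm' ?_ ht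
    filter_upwards [eventually_nhdsGT_zero_mem_Ioo] with x hx
    have hp := Real.rpow_pos_of_pos (hpos x hx) (1 / 4)
    have e : (x / (1 - x)) ^ (1 / 2 : ℝ) = (x / (1 - x)) ^ (1 / 4 : ℝ) * (x / (1 - x)) ^ (1 / 4 : ℝ) := by
      rw [← Real.rpow_add (hpos x hx)]; norm_num
    rw [norm_mul]
    calc ‖h x‖ * ‖B x‖ ≤ (C * (x / (1 - x)) ^ (1 / 2 : ℝ)) * (D * ((1 - x) / x) ^ (1 / 4 : ℝ)) :=
          mul_le_mul (hb x hx).2 (hd x hx) (norm_nonneg _)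
            (mul_nonneg hC (Real.rpow_nonneg (hpos x hx).le _))
      _ = _ := by rw [hinv x hx, e]; field_simp
  · obtain ⟨C, hC, hb⟩ := exists_abs_polylogSpan_le hh (α := 1 / 4) (by norm_num)
    obtain ⟨D, hD, hd⟩ := hB.growth (β := 1 / 2) (by norm_num)
    have ht := (tendsto_one_sub_div_rpow (α := 1 / 4) (by norm_num)).const_mul (C * D)
    rw [mul_zero] at ht
    refine squeeze_zero_norm' ?_ ht
    filter_upwards [eventually_nhdsLT_one_mem_Ioo] with x hx
    have hp := Real.rpow_pos_of_pos (hpos x hx) (1 / 4)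
    have e : (x / (1 - x)) ^ (1 / 2 : ℝ) = (x / (1 - x)) ^ (1 / 4 : ℝ) * (x / (1 - x)) ^ (1 / 4 : ℝ) := by
      rw [← Real.rpow_add (hpos x hx)]; norm_num
    rw [norm_mul]
    calc ‖h x‖ * ‖B x‖ ≤ (C * (x / (1 - x)) ^ (1 / 4 : ℝ)) * (D * ((1 - x) / x) ^ (1 / 2 : ℝ)) :=
          mul_le_mul (hb x hx).2 (hd x hx) (norm_nonneg _)
            (mul_nonneg hC (Real.rpow_nonneg (hpos x hx).le _))
      _ = _ := by rw [hinv x hx, hinv x hx, e]; field_simp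

/-- Repeated integration by parts moves the letters one by one from the dual polylogarithm `B` to
the polylogarithm `h`: the integral of `h' B` over the unit interval is a combination of
polylogarithms at one. -/
lemma IsDualPolylog.exists_primitive {B : ℝ → ℝ} (hB : IsDualPolylog B) {h : ℝ → ℝ}
    (hh : h ∈ polylogSpan ∅) :
    ∃ F : ℝ → ℝ, ∃ L ∈ polylogAlgebra, (∀ x ∈ Ioo (0 : ℝ) 1, HasDerivAt F (deriv h x * B x) x) ∧
      Tendsto F (𝓝[>] 0) (𝓝 0) ∧ Tendsto F (𝓝[<] 1) (𝓝 L) := by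
  induction hB generalizing h with
  | @base B g hg hd h1 =>
    have hBd := IsDualPolylog.base hg hd h1
    obtain ⟨k, hk, hkd⟩ := exists_polylogSpan_hasDerivAt_mul hg hh
    obtain ⟨L, hL, hkL⟩ := exists_tendsto_of_mem_polylogSpan hk
    obtain ⟨t0, t1⟩ := tendsto_mul_of_isDualPolylog hh hBd
    obtain ⟨_, _, hdiff⟩ := exists_abs_polylogSpan_le hh (α := 1 / 2) (by norm_num)
    refine ⟨fun x => h x * B x + k x, L, hL, fun x hx => ?_, ?_, ?_⟩
    · convert! ((hdiff x hx).1.hasDerivAt.mul (hd x hx)).add (hkd x hx) using 1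
      ring
    · simpa using t0.add (tendsto_zero_of_mem_polylogSpan hk)
    · simpa using t1.add hkL
  | @step A B g hg hA hd h1 ih =>
    have hBd := IsDualPolylog.step hg hA hd h1
    obtain ⟨k, hk, hkd⟩ := exists_polylogSpan_hasDerivAt_mul hg hh
    obtain ⟨F, L, hL, hFd, hF0, hF1⟩ := ih hk
    obtain ⟨t0, t1⟩ := tendsto_mul_of_isDualPolylog hh hBd
    obtain ⟨_, _, hdiff⟩ := exists_abs_polylogSpan_le hh (α := 1 / 2) (by norm_num)
    refine ⟨fun x => h x * B x + F x, L, hL, fun x hx => ?_, ?_, ?_⟩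
    · convert! ((hdiff x hx).1.hasDerivAt.mul (hd x hx)).add (hFd x hx) using 1
      rw [(hkd x hx).deriv]
      ring
    · simpa using t0.add hF0
    · simpa using t1.add hF1

/-- `B + F` is constant; comparing its limits at both ends gives the limit of `B` at `0`. -/
lemma tendsto_of_hasDerivAt_neg {B F b : ℝ → ℝ} {L : ℝ}
    (hB : ∀ y ∈ Ioo (0 : ℝ) 1, HasDerivAt B (-b y) y)
    (hF : ∀ y ∈ Ioo (0 : ℝ) 1, HasDerivAt F (b y) y) (hB1 : Tendsto B (𝓝[<] 1) (𝓝 0))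
    (hF0 : Tendsto F (𝓝[>] 0) (𝓝 0)) (hF1 : Tendsto F (𝓝[<] 1) (𝓝 L)) :
    Tendsto B (𝓝[>] 0) (𝓝 L) := by
  have hd : ∀ y ∈ Ioo (0 : ℝ) 1, HasDerivAt (fun y => B y + F y) 0 y := fun y hy => by
    simpa using (hB y hy).fun_add (hF y hy)
  obtain ⟨a, ha⟩ := isOpen_Ioo.exists_is_const_of_deriv_eq_zero isPreconnected_Ioo
    (fun y hy => (hd y hy).differentiableAt.differentiableWithinAt) (fun y hy => (hd y hy).deriv)
  have haL : a = L := by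
    have h1 : Tendsto (fun y => B y + F y) (𝓝[<] 1) (𝓝 L) := by simpa using hB1.add hF1
    refine tendsto_nhds_unique (Tendsto.congr' ?_ tendsto_const_nhds) h1
    filter_upwards [eventually_nhdsLT_one_mem_Ioo] with y hy using (ha y hy).symm
  have h2 : Tendsto (fun y => a - F y) (𝓝[>] 0) (𝓝 L) := by
    simpa [haL] using hF0.const_sub a
  refine h2.congr' ?_
  filter_upwards [eventually_nhdsGT_zero_mem_Ioo] with y hy
  rw [← ha y hy]; ring

/-- A dual polylogarithm whose outermost combination of letters has no pole at `0` has a limit at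
`0`, and this limit is a combination of polylogarithms at one (with the words reversed). -/
lemma IsDualPolylog.exists_tendsto_zero {A B g : ℝ → ℝ} (hg : g ∈ letterSpan {(0, 0)})
    (hA : IsDualPolylog A) (hd : ∀ y ∈ Ioo (0 : ℝ) 1, HasDerivAt B (-(g y * A y)) y)
    (h1 : Tendsto B (𝓝[<] 1) (𝓝 0)) :
    ∃ L ∈ polylogAlgebra, Tendsto B (𝓝[>] 0) (𝓝 L) := by
  obtain ⟨k, hk, hkd⟩ := exists_polylogSpan_hasDerivAt (mem_singleton _) hg
  obtain ⟨F, L, hL, hFd, hF0, hF1⟩ := hA.exists_primitive (polylogSpan_anti (empty_subset _) hk)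
  refine ⟨L, hL, tendsto_of_hasDerivAt_neg hd (fun y hy => ?_) h1 hF0 hF1⟩
  rw [← (hkd y hy).deriv]
  exact hFd y hy

lemma exists_tendsto_zero_of_hasDerivAt_neg {B g : ℝ → ℝ}
    (hg : g ∈ letterSpan {(0, 0), (1, 0)}) (hd : ∀ y ∈ Ioo (0 : ℝ) 1, HasDerivAt B (-g y) y)
    (h1 : Tendsto B (𝓝[<] 1) (𝓝 0)) :
    ∃ L ∈ polylogAlgebra, Tendsto B (𝓝[>] 0) (𝓝 L) := by
  obtain ⟨k, hk, hkd⟩ := exists_polylogSpan_hasDerivAt (by simp) hg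
  obtain ⟨L, hL, hkL⟩ := exists_tendsto_of_mem_polylogSpan
    (polylogSpan_anti (subset_insert _ _) hk)
  exact ⟨L, hL, tendsto_of_hasDerivAt_neg hd hkd h1 (tendsto_zero_of_mem_polylogSpan hk) hkL⟩

/-! ### Rising factorials and multiple harmonic sums -/

/-- The coefficient `(p)_n / n!` of the binomial series of `(1 - x) ^ (-p)`. -/
noncomputable def pochRatio (p : ℝ) (n : ℕ) : ℝ := (ascPochhammer ℝ n).eval p / (n.factorial : ℝ)

lemma pochRatio_zero (p : ℝ) : pochRatio p 0 = 1 := by simp [pochRatio]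

lemma succ_mul_pochRatio_succ (p : ℝ) (n : ℕ) :
    ((n : ℝ) + 1) * pochRatio p (n + 1) = (n + p) * pochRatio p n := by
  have h1 : (n.factorial : ℝ) ≠ 0 := by positivity
  have h2 : (n : ℝ) + 1 ≠ 0 := by positivity
  rw [pochRatio, pochRatio, ascPochhammer_succ_eval, Nat.factorial_succ]
  push_cast
  field_simp
  ring

lemma pochRatio_succ (p : ℝ) (n : ℕ) :
    pochRatio p (n + 1) = (n + p) / (n + 1) * pochRatio p n := by
  have h2 : (n : ℝ) + 1 ≠ 0 := by positivity
  rw [div_mul_eq_mul_div, ← succ_mul_pochRatio_succ, mul_div_cancel_left₀ _ h2]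

lemma pochRatio_nonneg {p : ℝ} (hp : 0 ≤ p) (n : ℕ) : 0 ≤ pochRatio p n := by
  induction n with
  | zero => simp [pochRatio_zero]
  | succ n ih => rw [pochRatio_succ]; positivity

lemma pochRatio_le_one {p : ℝ} (hp : 0 ≤ p) (hp1 : p ≤ 1) (n : ℕ) : pochRatio p n ≤ 1 := by
  induction n with
  | zero => simp [pochRatio_zero]
  | succ n ih =>
    rw [pochRatio_succ]
    have h : (n + p) / ((n : ℝ) + 1) ≤ 1 := by
      rw [div_le_one (by positivity)]; linarith
    exact mul_le_one₀ h (pochRatio_nonneg hp n) ih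

lemma pochRatio_one (n : ℕ) : pochRatio 1 n = 1 := by
  induction n with
  | zero => simp [pochRatio_zero]
  | succ n ih => rw [pochRatio_succ, ih, mul_one, div_self (by positivity)]

lemma div_le_pochRatio {p : ℝ} (hp : 0 ≤ p) (n : ℕ) : p / (n + 1) ≤ pochRatio p (n + 1) := by
  induction n with
  | zero => rw [pochRatio_succ, pochRatio_zero]; simp
  | succ n ih =>
    rw [pochRatio_succ]
    have h : 0 ≤ ((n + 1 : ℕ) + p) / ((n + 1 : ℕ) + 1 : ℝ) := by positivity
    refine le_trans ?_ (mul_le_mul_of_nonneg_left ih h)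
    rw [div_mul_div_comm, div_le_div_iff₀ (by positivity) (by positivity)]
    push_cast
    have h3 : 0 ≤ (n : ℝ) := by positivity
    nlinarith [mul_nonneg (mul_nonneg hp hp) (by positivity : (0 : ℝ) ≤ n + 1 + 1)]

lemma multipleHarmonicSum_zero (k : ℕ) (ks : List ℕ) : multipleHarmonicSum (k :: ks) 0 = 0 := by
  simp [multipleHarmonicSum]

lemma multipleHarmonicSum_succ (k : ℕ) (ks : List ℕ) (n : ℕ) :
    multipleHarmonicSum (k :: ks) (n + 1) = multipleHarmonicSum (k :: ks) n
      + 1 / ((n : ℝ) + 1) ^ k * multipleHarmonicSum ks (n + 1) := by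
  rw [multipleHarmonicSum, multipleHarmonicSum, Finset.sum_Icc_succ_top (by omega)]
  push_cast
  rfl

lemma multipleHarmonicSum_nonneg (cs : List ℕ) (n : ℕ) : 0 ≤ multipleHarmonicSum cs n := by
  induction cs generalizing n with
  | nil => simp [multipleHarmonicSum]
  | cons k ks ih =>
    rw [multipleHarmonicSum]
    exact Finset.sum_nonneg fun i _ => mul_nonneg (by positivity) (ih i)

lemma one_le_multipleHarmonicSum (cs : List ℕ) (n : ℕ) : 1 ≤ multipleHarmonicSum cs (n + 1) := by
  induction cs generalizing n with
  | nil => simp [multipleHarmonicSum]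
  | cons k ks ih =>
    rw [multipleHarmonicSum]
    have h := Finset.single_le_sum (s := Finset.Icc 1 (n + 1)) (a := 1)
      (f := fun i : ℕ => 1 / (i : ℝ) ^ k * multipleHarmonicSum ks i)
      (fun i _ => mul_nonneg (by positivity) (multipleHarmonicSum_nonneg ks i)) (by simp)
    refine le_trans ?_ h
    simpa using ih 0

lemma multipleHarmonicSum_le (cs : List ℕ) (n : ℕ) :
    multipleHarmonicSum cs n ≤ ((n : ℝ) + 1) ^ cs.length := by
  induction cs generalizing n with
  | nil => simp [multipleHarmonicSum]
  | cons k ks ih =>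
    rw [multipleHarmonicSum, List.length_cons, pow_succ']
    calc ∑ i ∈ Finset.Icc 1 n, 1 / (i : ℝ) ^ k * multipleHarmonicSum ks i
        ≤ ∑ i ∈ Finset.Icc 1 n, ((n : ℝ) + 1) ^ ks.length := by
          refine Finset.sum_le_sum fun i hi => ?_
          obtain ⟨h1, h2⟩ := Finset.mem_Icc.1 hi
          have h1' : (1 : ℝ) ≤ i := by exact_mod_cast h1
          have h2' : (i : ℝ) ≤ n := by exact_mod_cast h2
          have h3 : 1 / (i : ℝ) ^ k ≤ 1 := by
            rw [div_le_one (by positivity)]; exact one_le_pow₀ h1'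
          calc 1 / (i : ℝ) ^ k * multipleHarmonicSum ks i ≤ 1 * multipleHarmonicSum ks i :=
                mul_le_mul_of_nonneg_right h3 (multipleHarmonicSum_nonneg ks i)
            _ ≤ ((i : ℝ) + 1) ^ ks.length := by rw [one_mul]; exact ih i
            _ ≤ _ := by gcongr
      _ = n * ((n : ℝ) + 1) ^ ks.length := by simp
      _ ≤ _ := by gcongr; linarith

/-! ### Generating functions -/

lemma summable_succ_pow_mul_geometric (K : ℕ) {r : ℝ} (h0 : 0 ≤ r) (h1 : r < 1) :
    Summable fun n : ℕ => ((n : ℝ) + 1) ^ K * r ^ n := by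
  rcases h0.eq_or_lt with rfl | h0
  · refine summable_of_ne_finset_zero (s := {0}) fun n hn => ?_
    simp at hn; simp [hn]
  have := (summable_nat_add_iff 1).2
    (summable_pow_mul_geometric_of_norm_lt_one K (r := r) (by rwa [Real.norm_of_nonneg h0.le]))
  refine (this.mul_left r⁻¹).congr fun n => ?_
  rw [pow_succ' r n]
  push_cast
  field_simp

lemma summable_of_abs_le_succ_pow {a : ℕ → ℝ} {K : ℕ} (ha : ∀ n, |a n| ≤ ((n : ℝ) + 1) ^ K) {x : ℝ}
    (hx : |x| < 1) : Summable fun n => a n * x ^ n := by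
  refine Summable.of_norm_bounded (summable_succ_pow_mul_geometric K (abs_nonneg x) hx) fun n => ?_
  rw [norm_mul, norm_pow]
  exact mul_le_mul_of_nonneg_right (ha n) (by positivity)

lemma abs_succ_mul_succ_le {a : ℕ → ℝ} {K : ℕ} (ha : ∀ n, |a n| ≤ ((n : ℝ) + 1) ^ K) (n : ℕ) :
    |((n : ℝ) + 1) * a (n + 1)| ≤ 2 ^ K * ((n : ℝ) + 1) ^ (K + 1) := by
  rw [abs_mul, abs_of_nonneg (by positivity : (0 : ℝ) ≤ n + 1)]
  calc ((n : ℝ) + 1) * |a (n + 1)| ≤ (n + 1) * ((n + 1 : ℕ) + 1 : ℝ) ^ K := by gcongr; exact ha _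
    _ ≤ (n + 1) * (2 * ((n : ℝ) + 1)) ^ K := by
        gcongr; push_cast; linarith [(Nat.cast_nonneg n : (0 : ℝ) ≤ n)]
    _ = _ := by rw [mul_pow]; ring

lemma hasSum_derivSeries {a : ℕ → ℝ} {K : ℕ} (ha : ∀ n, |a n| ≤ ((n : ℝ) + 1) ^ K) {x : ℝ}
    (hx : |x| < 1) : HasSum (fun n : ℕ => n * a n * x ^ n)
      (x * ∑' n : ℕ, ((n : ℝ) + 1) * a (n + 1) * x ^ n) := by
  have hs : Summable fun n : ℕ => ((n : ℝ) + 1) * a (n + 1) * x ^ n := by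
    refine Summable.of_norm_bounded
      ((summable_succ_pow_mul_geometric (K + 1) (abs_nonneg x) hx).mul_left (2 ^ K)) fun n => ?_
    rw [norm_mul, norm_pow, ← mul_assoc]
    exact mul_le_mul_of_nonneg_right (abs_succ_mul_succ_le ha n) (by positivity)
  rw [← hasSum_nat_add_iff' 1]
  simp only [Finset.range_one, Finset.sum_singleton, Nat.cast_zero, zero_mul, sub_zero]
  refine (hs.hasSum.mul_left x).congr_fun fun n => ?_
  push_cast
  ring

lemma hasDerivAt_tsum_mul_pow {a : ℕ → ℝ} {K : ℕ} (ha : ∀ n, |a n| ≤ ((n : ℝ) + 1) ^ K) {x : ℝ}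
    (hx : |x| < 1) : HasDerivAt (fun x => ∑' n, a n * x ^ n)
      (∑' n : ℕ, ((n : ℝ) + 1) * a (n + 1) * x ^ n) x := by
  obtain ⟨r, hxr, hr1⟩ := exists_between hx
  have hr0 : 0 < r := (abs_nonneg x).trans_lt hxr
  have hu : Summable fun n : ℕ => |a n| * (n * r ^ (n - 1)) := by
    rw [← summable_nat_add_iff 1]
    refine Summable.of_nonneg_of_le (fun n => by positivity) (fun n => ?_)
      ((summable_succ_pow_mul_geometric (K + 1) hr0.le hr1).mul_left (2 ^ K))
    have := abs_succ_mul_succ_le ha n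
    rw [abs_mul, abs_of_nonneg (by positivity : (0 : ℝ) ≤ n + 1)] at this
    push_cast
    rw [← mul_assoc, mul_comm |a (n + 1)|, ← mul_assoc]
    exact mul_le_mul_of_nonneg_right this (by positivity)
  have h := hasDerivAt_tsum_of_isPreconnected (g := fun n x => a n * x ^ n)
    (g' := fun n x => a n * (n * x ^ (n - 1))) (t := Ioo (-r) r) (y₀ := 0) (y := x) hu isOpen_Ioo
    isPreconnected_Ioo (fun n y _ => (hasDerivAt_pow n y).const_mul (a n)) (fun n y hy => by
      rw [norm_mul, norm_mul, norm_pow, Real.norm_natCast, Real.norm_eq_abs]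
      have : ‖y‖ ≤ r := abs_le.2 ⟨hy.1.le, hy.2.le⟩
      gcongr) (by simp [hr0]) (summable_of_abs_le_succ_pow ha (by simp)) (abs_lt.1 hxr)
  convert! h using 1
  have hsum : Summable fun n : ℕ => a n * (n * x ^ (n - 1)) := by
    refine Summable.of_norm_bounded hu fun n => ?_
    rw [norm_mul, norm_mul, norm_pow, Real.norm_natCast, Real.norm_eq_abs, Real.norm_eq_abs]
    gcongr
  rw [hsum.tsum_eq_zero_add]
  simp only [Nat.cast_zero, zero_mul, mul_zero, zero_add, Nat.add_sub_cancel]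
  refine tsum_congr fun n => ?_
  push_cast
  ring

/-- The coefficients `(p)_n / n! * S_{cs}(n) / n ^ c`; for `n = 0` the value is `0`, except for
`c = 0` and empty `cs`. -/
noncomputable def coeff (p : ℝ) (c : ℕ) (cs : List ℕ) (n : ℕ) : ℝ :=
  pochRatio p n * multipleHarmonicSum cs n / (n : ℝ) ^ c

/-- The generating function of `coeff p c cs`. -/
noncomputable def genFun (p : ℝ) (c : ℕ) (cs : List ℕ) (x : ℝ) : ℝ := ∑' n, coeff p c cs n * x ^ n

lemma coeff_nonneg {p : ℝ} (hp : 0 ≤ p) (c : ℕ) (cs : List ℕ) (n : ℕ) : 0 ≤ coeff p c cs n :=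
  div_nonneg (mul_nonneg (pochRatio_nonneg hp n) (multipleHarmonicSum_nonneg cs n)) (by positivity)

lemma abs_coeff_le {p : ℝ} (hp : 0 ≤ p) (hp1 : p ≤ 1) (c : ℕ) (cs : List ℕ) (n : ℕ) :
    |coeff p c cs n| ≤ ((n : ℝ) + 1) ^ cs.length := by
  rw [abs_of_nonneg (coeff_nonneg hp c cs n), coeff]
  have h1 := pochRatio_le_one hp hp1 n
  have h2 := pochRatio_nonneg hp n
  have h3 := multipleHarmonicSum_nonneg cs n
  have h4 := multipleHarmonicSum_le cs n
  have h5 : pochRatio p n * multipleHarmonicSum cs n ≤ ((n : ℝ) + 1) ^ cs.length :=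
    (mul_le_of_le_one_left h3 h1).trans h4
  rcases Nat.eq_zero_or_pos n with rfl | hn
  · rcases Nat.eq_zero_or_pos c with rfl | hc
    · simpa using h5
    · simp [hc.ne']
  · have : (1 : ℝ) ≤ (n : ℝ) ^ c := one_le_pow₀ (by exact_mod_cast hn)
    exact (div_le_self (mul_nonneg h2 h3) this).trans h5

lemma coeff_zero_eq_zero {c : ℕ} {cs : List ℕ} (h : c ≠ 0 ∨ cs ≠ []) (p : ℝ) :
    coeff p c cs 0 = 0 := by
  rcases h with h | h
  · simp [coeff, h]
  · obtain ⟨k, ks, rfl⟩ := List.exists_cons_of_ne_nil h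
    simp [coeff, multipleHarmonicSum_zero]

lemma coeff_nil_zero (p : ℝ) : coeff p 0 [] 0 = 1 := by
  simp [coeff, pochRatio_zero, multipleHarmonicSum]

lemma genFun_zero (p : ℝ) (c : ℕ) (cs : List ℕ) : genFun p c cs 0 = coeff p c cs 0 := by
  rw [genFun, tsum_eq_single 0 fun n hn => by simp [hn]]
  simp

lemma exists_hasDerivAt_genFun_succ {p : ℝ} (hp : 0 ≤ p) (hp1 : p ≤ 1) (c : ℕ) (cs : List ℕ)
    {x : ℝ} (hx : |x| < 1) :
    ∃ D, HasDerivAt (genFun p (c + 1) cs) D x ∧ x * D = genFun p c cs x - coeff p c cs 0 := by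
  have hb := abs_coeff_le hp hp1 (c + 1) cs
  refine ⟨_, hasDerivAt_tsum_mul_pow hb hx, ?_⟩
  have h1 := hasSum_derivSeries hb hx
  have h2 := (summable_of_abs_le_succ_pow (abs_coeff_le hp hp1 c cs) hx).hasSum
  rw [← hasSum_nat_add_iff' 1] at h1 h2
  simp only [Finset.range_one, Finset.sum_singleton, Nat.cast_zero, zero_mul, sub_zero, pow_zero,
    mul_one] at h1 h2
  refine h1.unique (h2.congr_fun fun n => ?_)
  have : ((n + 1 : ℕ) : ℝ) ≠ 0 := by positivity
  simp only [coeff]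
  field_simp
  ring

lemma exists_hasDerivAt_genFun_zero_cons {p : ℝ} (hp : 0 ≤ p) (hp1 : p ≤ 1) (c : ℕ) (cs : List ℕ)
    {x : ℝ} (hx : |x| < 1) :
    ∃ D, HasDerivAt (genFun p 0 ((c + 1) :: cs)) D x ∧
      x * ((1 - x) * D - p * genFun p 0 ((c + 1) :: cs) x)
        = genFun p c cs x - coeff p c cs 0 := by
  have hb := abs_coeff_le hp hp1 0 ((c + 1) :: cs)
  refine ⟨_, hasDerivAt_tsum_mul_pow hb hx, ?_⟩
  set D := ∑' n : ℕ, ((n : ℝ) + 1) * coeff p 0 ((c + 1) :: cs) (n + 1) * x ^ n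
  have h1 := hasSum_derivSeries hb hx
  have h2 := (summable_of_abs_le_succ_pow (abs_coeff_le hp hp1 c cs) hx).hasSum
  have h3 := (summable_of_abs_le_succ_pow hb hx).hasSum
  have h4 := ((h1.add (h3.mul_left p)).mul_left x)
  rw [← hasSum_nat_add_iff' 1] at h1 h2
  simp only [Finset.range_one, Finset.sum_singleton, Nat.cast_zero, zero_mul, sub_zero, pow_zero,
    mul_one] at h1 h2
  have h5 := h1.sub h4
  have h6 : x * D - x * (x * D + p * ∑' n, coeff p 0 ((c + 1) :: cs) n * x ^ n)
      = (∑' n, coeff p c cs n * x ^ n) - coeff p c cs 0 := by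
    refine h5.unique (h2.congr_fun fun n => ?_)
    have hn : ((n + 1 : ℕ) : ℝ) ≠ 0 := by positivity
    have hn' : (n : ℝ) + 1 ≠ 0 := by positivity
    simp only [coeff, pow_zero, div_one]
    rw [multipleHarmonicSum_succ, pochRatio_succ]
    push_cast
    field_simp
    ring
  rw [genFun, genFun, ← h6]
  ring

lemma exists_hasDerivAt_genFun_zero_nil {p : ℝ} (hp : 0 ≤ p) (hp1 : p ≤ 1) {x : ℝ}
    (hx : |x| < 1) :
    ∃ D, HasDerivAt (genFun p 0 []) D x ∧ (1 - x) * D - p * genFun p 0 [] x = 0 := by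
  have hb := abs_coeff_le hp hp1 0 []
  refine ⟨_, hasDerivAt_tsum_mul_pow hb hx, ?_⟩
  have h1 := hasSum_derivSeries hb hx
  have h3 := (summable_of_abs_le_succ_pow hb hx).hasSum
  have h4 := h1.add (h3.mul_left p)
  rw [sub_mul, one_mul, sub_sub, sub_eq_zero]
  rw [genFun, ← h4.tsum_eq]
  refine tsum_congr fun n => ?_
  simp only [coeff, pow_zero, div_one, multipleHarmonicSum, mul_one]
  rw [succ_mul_pochRatio_succ]
  ring

/-! ### Generating functions as iterated integrals -/

lemma one_sub_pow_mem_Ioo {s : ℕ} (hs : 0 < s) {y : ℝ} (hy : y ∈ Ioo (0 : ℝ) 1) :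
    1 - y ^ s ∈ Ioo (0 : ℝ) 1 :=
  ⟨sub_pos.2 (pow_lt_one₀ hy.1.le hy.2 hs.ne'), by linarith [pow_pos hy.1 s]⟩

lemma hasDerivAt_one_sub_pow (s : ℕ) (y : ℝ) :
    HasDerivAt (fun y : ℝ => 1 - y ^ s) (-(s * y ^ (s - 1))) y := by
  simpa using (hasDerivAt_pow s y).const_sub 1

lemma ratio_nonneg_le_one {k s : ℕ} (hk : 0 < k) (hks : k ≤ s) :
    (0 : ℝ) ≤ (k : ℝ) / s ∧ (k : ℝ) / s ≤ 1 := by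
  have hs : (0 : ℝ) < s := by exact_mod_cast hk.trans_le hks
  exact ⟨by positivity, by rw [div_le_one hs]; exact_mod_cast hks⟩

/-- The derivative of `F(1 - y ^ s)` for the generating function `F` with one more factor
`1 / n`. -/
lemma hasDerivAt_genFun_succ {k s : ℕ} (hk : 0 < k) (hks : k ≤ s) (c : ℕ) (cs : List ℕ) {y : ℝ}
    (hy : y ∈ Ioo (0 : ℝ) 1) :
    HasDerivAt (fun y => genFun (k / s) (c + 1) cs (1 - y ^ s))
      (-(s * (y ^ s / (y * (1 - y ^ s))) *
        (genFun (k / s) c cs (1 - y ^ s) - coeff (k / s) c cs 0))) y := by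
  obtain ⟨hp, hp1⟩ := ratio_nonneg_le_one hk hks
  have hs : 0 < s := hk.trans_le hks
  have hx := one_sub_pow_mem_Ioo hs hy
  obtain ⟨D, hD, hDe⟩ := exists_hasDerivAt_genFun_succ hp hp1 c cs
    (show |1 - y ^ s| < 1 by rw [abs_of_pos hx.1]; exact hx.2)
  convert! HasDerivAt.comp y hD (hasDerivAt_one_sub_pow s y) using 1
  rw [← hDe]
  have h1 := hx.1.ne'
  have h0 := hy.1.ne'
  obtain ⟨t, rfl⟩ : ∃ t, s = t + 1 := ⟨s - 1, by omega⟩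
  rw [Nat.add_sub_cancel]
  field_simp
  ring

/-- In terms of `y ^ k * F(1 - y ^ s)`, where `y ^ k = (1 - x) ^ (k / s)` is the integrating factor,
summation over the first index becomes an integration. -/
lemma hasDerivAt_pow_mul_genFun {k s : ℕ} (hk : 0 < k) (hks : k ≤ s) (c : ℕ) (cs : List ℕ) {y : ℝ}
    (hy : y ∈ Ioo (0 : ℝ) 1) :
    HasDerivAt (fun y => y ^ k * genFun (k / s) 0 ((c + 1) :: cs) (1 - y ^ s))
      (-(s * (y ^ k / (y * (1 - y ^ s))) *
        (genFun (k / s) c cs (1 - y ^ s) - coeff (k / s) c cs 0))) y := by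
  obtain ⟨hp, hp1⟩ := ratio_nonneg_le_one hk hks
  have hs : 0 < s := hk.trans_le hks
  have hx := one_sub_pow_mem_Ioo hs hy
  obtain ⟨D, hD, hDe⟩ := exists_hasDerivAt_genFun_zero_cons hp hp1 c cs
    (show |1 - y ^ s| < 1 by rw [abs_of_pos hx.1]; exact hx.2)
  convert! (hasDerivAt_pow k y).mul (HasDerivAt.comp y hD (hasDerivAt_one_sub_pow s y)) using 1
  rw [← hDe]
  have h1 := hx.1.ne'
  have h0 := hy.1.ne'
  have hs' : (s : ℝ) ≠ 0 := by positivity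
  obtain ⟨t, rfl⟩ : ∃ t, s = t + 1 := ⟨s - 1, by omega⟩
  obtain ⟨l, rfl⟩ : ∃ l, k = l + 1 := ⟨k - 1, by omega⟩
  simp only [Nat.add_sub_cancel, Function.comp_apply]
  generalize genFun _ 0 ((c + 1) :: cs) (1 - y ^ (t + 1)) = G
  field_simp
  ring

/-- The binomial series `∑ (p)_n / n! * x ^ n = (1 - x) ^ (-p)` at `x = 1 - y ^ s`. -/
lemma pow_mul_genFun_nil {k s : ℕ} (hk : 0 < k) (hks : k ≤ s) {y : ℝ} (hy : y ∈ Ioo (0 : ℝ) 1) :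
    y ^ k * genFun (k / s) 0 [] (1 - y ^ s) = 1 := by
  obtain ⟨hp, hp1⟩ := ratio_nonneg_le_one hk hks
  have hs : 0 < s := hk.trans_le hks
  have hs' : (s : ℝ) ≠ 0 := by positivity
  have hd : ∀ z : ℝ, |1 - z ^ s| < 1 → HasDerivAt
      (fun y => y ^ k * genFun (k / s) 0 [] (1 - y ^ s)) 0 z := by
    intro z hz
    obtain ⟨D, hD, hDe⟩ := exists_hasDerivAt_genFun_zero_nil hp hp1 hz
    convert! (hasDerivAt_pow k z).mul (HasDerivAt.comp z hD (hasDerivAt_one_sub_pow s z)) using 1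
    rw [sub_sub_cancel, sub_eq_zero] at hDe
    obtain ⟨t, rfl⟩ : ∃ t, s = t + 1 := ⟨s - 1, by omega⟩
    obtain ⟨l, rfl⟩ : ∃ l, k = l + 1 := ⟨k - 1, by omega⟩
    simp only [Nat.add_sub_cancel, Function.comp_apply]
    have : z ^ (l + 1) * (D * -(((t + 1 : ℕ) : ℝ) * z ^ t))
        = -(((t + 1 : ℕ) : ℝ) * z ^ l * (z ^ (t + 1) * D)) := by ring
    rw [this, hDe]
    field_simp
    ring
  -- the function is constant on `(0, 1]`, with value `1` at `1`
  have hcont : ∀ z ∈ Icc y 1, HasDerivAt (fun y => y ^ k * genFun (k / s) 0 [] (1 - y ^ s)) 0 z := by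
    refine fun z hz => hd z ?_
    have h0 : 0 < z := hy.1.trans_le hz.1
    have h1 := pow_le_one₀ (n := s) h0.le hz.2
    rw [abs_of_nonneg (by linarith)]
    linarith [pow_pos h0 s]
  have := constant_of_has_deriv_right_zero
    (fun z hz => (hcont z hz).continuousAt.continuousWithinAt)
    (fun z hz => (hcont z ⟨hz.1, hz.2.le⟩).hasDerivWithinAt) 1 ⟨hy.2.le, le_rfl⟩
  rw [← this, one_pow, one_pow, sub_self, genFun_zero, coeff_nil_zero, mul_one]

lemma tendsto_genFun_one {k s : ℕ} (hk : 0 < k) (hks : k ≤ s) {c : ℕ} {cs : List ℕ}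
    (h : c ≠ 0 ∨ cs ≠ []) :
    Tendsto (fun y : ℝ => genFun (k / s) c cs (1 - y ^ s)) (𝓝[<] 1) (𝓝 0) := by
  obtain ⟨hp, hp1⟩ := ratio_nonneg_le_one hk hks
  have h0 := (hasDerivAt_tsum_mul_pow (abs_coeff_le hp hp1 c cs) (x := 0) (by simp)).continuousAt
  have h1 : Tendsto (genFun (k / s) c cs) (𝓝 0) (𝓝 0) := by
    have := h0.tendsto
    change Tendsto _ _ (𝓝 (genFun (k / s) c cs 0)) at this
    rwa [genFun_zero, coeff_zero_eq_zero h] at this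
  have h2 : Tendsto (fun y : ℝ => 1 - y ^ s) (𝓝[<] 1) (𝓝 0) := by
    have : ContinuousAt (fun y : ℝ => 1 - y ^ s) 1 := by fun_prop
    have := this.tendsto
    rw [one_pow, sub_self] at this
    exact this.mono_left nhdsWithin_le_nhds
  exact h1.comp h2

lemma exists_natCast_mul_mem {E : Set (ℕ × ℕ)} {f : ℝ → ℝ} (s : ℕ)
    (h : ∃ g ∈ letterSpan E, ∀ y ∈ Ioo (0 : ℝ) 1, g y = f y) :
    ∃ g ∈ letterSpan E, ∀ y ∈ Ioo (0 : ℝ) 1, g y = s * f y := by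
  obtain ⟨g, hg, hgy⟩ := h
  refine ⟨(s : ℚ) • g, Submodule.smul_mem _ _ hg, fun y hy => ?_⟩
  rw [Pi.smul_apply, hgy y hy, Rat.smul_def, Rat.cast_natCast]

/-- The generating functions attached to `cs`, with `y ^ k` as an additional factor if there is no
power of `1 / n`, are dual polylogarithms in `y`. -/
def GenFunsAreDual (k s : ℕ) (cs : List ℕ) : Prop :=
  (∀ c, IsDualPolylog fun y => genFun (k / s) (c + 1) cs (1 - y ^ s)) ∧
    (cs ≠ [] → IsDualPolylog fun y => y ^ k * genFun (k / s) 0 cs (1 - y ^ s))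

/-- One more integration over `s * y ^ j / (y * (1 - y ^ s))`. The factor `y ^ (-k)` by which
`genFun` differs from a dual polylogarithm if `c = 0` is absorbed into the kernel, which is
possible because `k ≤ j`. For `c = 0` and empty `cs` the integrand is `y ^ (-k) - 1` times the
kernel, and the pole at `1` cancels. -/
lemma isDualPolylog_of_hasDerivAt {k s : ℕ} (hk : 0 < k) (hks : k ≤ s) {c : ℕ} {cs : List ℕ}
    (h : c ≠ 0 → IsDualPolylog fun y => genFun (k / s) c cs (1 - y ^ s))
    (h' : cs ≠ [] → IsDualPolylog fun y => y ^ k * genFun (k / s) 0 cs (1 - y ^ s))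
    {j : ℕ} (hkj : k ≤ j) (hjs : j ≤ s) {B : ℝ → ℝ}
    (hB : ∀ y ∈ Ioo (0 : ℝ) 1, HasDerivAt B (-(s * (y ^ j / (y * (1 - y ^ s))) *
        (genFun (k / s) c cs (1 - y ^ s) - coeff (k / s) c cs 0))) y)
    (h1 : Tendsto B (𝓝[<] 1) (𝓝 0)) : IsDualPolylog B := by
  have hs : 0 < s := hk.trans_le hks
  have hkey : ∀ y ∈ Ioo (0 : ℝ) 1, y ^ j / (y * (1 - y ^ s))
      = y ^ (j - k) / (y * (1 - y ^ s)) * y ^ k := fun y hy => by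
    rw [div_mul_eq_mul_div, ← pow_add, Nat.sub_add_cancel hkj]
  by_cases hc : c = 0
  · subst hc
    by_cases hcs : cs = []
    · subst hcs
      obtain ⟨g, hg, hgy⟩ := exists_natCast_mul_mem s
        (exists_letterSpan_eq_sub (s := s) (i := j - k) (j := j) (by omega) (by omega) hjs)
      refine .base hg (fun y hy => ?_) h1
      convert! hB y hy using 1
      have h2 := pow_mul_genFun_nil hk hks hy
      rw [hgy y hy, coeff_nil_zero, sub_div, mul_assoc, mul_sub (y ^ j / _), mul_one,
        hkey y hy, mul_assoc, h2, mul_one]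
    · obtain ⟨g, hg, hgy⟩ := exists_natCast_mul_mem s
        (exists_letterSpan_eq hs (show j - k ≤ s by omega))
      refine .step hg (h' hcs) (fun y hy => ?_) h1
      convert! hB y hy using 1
      rw [hgy y hy, coeff_zero_eq_zero (Or.inr hcs), hkey y hy, sub_zero]
      ring
  · obtain ⟨g, hg, hgy⟩ := exists_natCast_mul_mem s (exists_letterSpan_eq hs hjs)
    refine .step hg (h hc) (fun y hy => ?_) h1
    convert! hB y hy using 1
    rw [hgy y hy, coeff_zero_eq_zero (Or.inl hc), sub_zero]

lemma genFunsAreDual {k s : ℕ} (hk : 0 < k) (hks : k ≤ s) (cs : List ℕ) (hcs : ∀ c ∈ cs, 1 ≤ c) :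
    GenFunsAreDual k s cs := by
  -- raising the power of `1 / n`, once the sum without such a power is dealt with
  have hup : ∀ cs : List ℕ,
      (cs ≠ [] → IsDualPolylog fun y => y ^ k * genFun (k / s) 0 cs (1 - y ^ s)) →
      GenFunsAreDual k s cs := by
    intro cs h
    refine ⟨fun c => ?_, h⟩
    induction c with
    | zero =>
      exact isDualPolylog_of_hasDerivAt hk hks (fun h => absurd rfl h) h hks le_rfl
        (fun y hy => hasDerivAt_genFun_succ hk hks 0 cs hy) (tendsto_genFun_one hk hks (by simp))
    | succ c ih =>
      exact isDualPolylog_of_hasDerivAt hk hks (fun _ => ih) h hks le_rfl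
        (fun y hy => hasDerivAt_genFun_succ hk hks (c + 1) cs hy)
        (tendsto_genFun_one hk hks (by simp))
  induction cs with
  | nil => exact hup [] (by simp)
  | cons c1 cs ih =>
    obtain ⟨ih1, ih2⟩ := ih fun c hc => hcs c (by simp [hc])
    obtain ⟨c, rfl⟩ : ∃ c, c1 = c + 1 := ⟨c1 - 1, by have := hcs c1 (by simp); omega⟩
    refine hup _ fun _ => ?_
    refine isDualPolylog_of_hasDerivAt hk hks (c := c) (fun hc => ?_) ih2 le_rfl hks
      (fun y hy => hasDerivAt_pow_mul_genFun hk hks c cs hy) ?_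
    · obtain ⟨c, rfl⟩ : ∃ c', c = c' + 1 := ⟨c - 1, by omega⟩
      exact ih1 c
    · have h1 := tendsto_genFun_one hk hks (c := 0) (cs := (c + 1) :: cs) (by simp)
      have h2 : Tendsto (fun y : ℝ => y ^ k) (𝓝[<] 1) (𝓝 1) := by
        have := ((continuous_pow k).tendsto (1 : ℝ)).mono_left (nhdsWithin_le_nhds (s := Iio 1))
        simpa using this
      simpa using h2.mul h1

/-- The limit at `x = 1`, that is at `y = 0`. In the excluded case `c = 0`, `k = s`, the outermost
kernel has a pole at `y = 0`, and the series at `x = 1` diverges. -/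
lemma exists_tendsto_genFun {k s : ℕ} (hk : 0 < k) (hks : k ≤ s) (cs : List ℕ)
    (hcs : ∀ c ∈ cs, 1 ≤ c) (c : ℕ) (hc : c ≠ 0 ∨ k < s) :
    ∃ L ∈ polylogAlgebra,
      Tendsto (fun y : ℝ => genFun (k / s) (c + 1) cs (1 - y ^ s)) (𝓝[>] 0) (𝓝 L) := by
  have hs : 0 < s := hk.trans_le hks
  obtain ⟨h1, h2⟩ := genFunsAreDual hk hks cs hcs
  have hd := fun y hy => hasDerivAt_genFun_succ hk hks c cs (y := y) hy
  have ht := tendsto_genFun_one hk hks (c := c + 1) (cs := cs) (by simp)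
  have hkey : ∀ y ∈ Ioo (0 : ℝ) 1, y ^ s / (y * (1 - y ^ s))
      = y ^ (s - k) / (y * (1 - y ^ s)) * y ^ k := fun y hy => by
    rw [div_mul_eq_mul_div, ← pow_add, Nat.sub_add_cancel hks]
  by_cases hc0 : c = 0
  · subst hc0
    have hks' : k < s := hc.resolve_left (by simp)
    by_cases hcs0 : cs = []
    · subst hcs0
      obtain ⟨g, hg, hgy⟩ := exists_natCast_mul_mem s
        (exists_letterSpan_eq_sub_of_pos (s := s) (i := s - k) (j := s) (by omega) (by omega) hs
          le_rfl)
      refine exists_tendsto_zero_of_hasDerivAt_neg hg (fun y hy => ?_) ht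
      convert! hd y hy using 1
      have h2 := pow_mul_genFun_nil hk hks hy
      rw [hgy y hy, coeff_nil_zero, sub_div, mul_assoc, mul_sub (y ^ s / _), mul_one,
        hkey y hy, mul_assoc, h2, mul_one]
    · obtain ⟨g, hg, hgy⟩ := exists_natCast_mul_mem s
        (exists_letterSpan_eq_of_pos (show 1 ≤ s - k by omega) (show s - k ≤ s by omega))
      refine IsDualPolylog.exists_tendsto_zero hg (h2 hcs0) (fun y hy => ?_) ht
      convert! hd y hy using 1
      rw [hgy y hy, coeff_zero_eq_zero (Or.inr hcs0), hkey y hy, sub_zero]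
      ring
  · obtain ⟨g, hg, hgy⟩ := exists_natCast_mul_mem s (exists_letterSpan_eq_of_pos hs le_rfl)
    obtain ⟨c, rfl⟩ : ∃ c', c = c' + 1 := ⟨c - 1, by omega⟩
    refine IsDualPolylog.exists_tendsto_zero hg (h1 c) (fun y hy => ?_) ht
    convert! hd y hy using 1
    rw [hgy y hy, coeff_zero_eq_zero (by simp), sub_zero]

/-- The value of the series with a single power of `n` in the denominator. Its convergence comes for
free, since the terms are nonnegative and the generating function has a limit. -/
lemma exists_hasSum_coeff {k s : ℕ} (hk : 0 < k) (hks : k ≤ s) (cs : List ℕ)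
    (hcs : ∀ c ∈ cs, 1 ≤ c) (c : ℕ) (hc : c ≠ 0 ∨ k < s) :
    ∃ L ∈ polylogAlgebra, HasSum (coeff (k / s) (c + 1) cs) L := by
  obtain ⟨hp, hp1⟩ := ratio_nonneg_le_one hk hks
  have hs : 0 < s := hk.trans_le hks
  obtain ⟨L, hL, ht⟩ := exists_tendsto_genFun hk hks cs hcs c hc
  have hx : Tendsto (fun y : ℝ => 1 - y ^ s) (𝓝[>] 0) (𝓝 1) := by
    have : ContinuousAt (fun y : ℝ => 1 - y ^ s) 0 := by fun_prop
    have := this.tendsto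
    rw [zero_pow hs.ne', sub_zero] at this
    exact this.mono_left nhdsWithin_le_nhds
  have hsum : Summable (coeff (k / s) (c + 1) cs) := by
    refine summable_of_sum_range_le (c := L) (coeff_nonneg hp _ _) fun N => ?_
    have h1 : Tendsto (fun y : ℝ => ∑ n ∈ Finset.range N, coeff (k / s) (c + 1) cs n * (1 - y ^ s) ^ n)
        (𝓝[>] 0) (𝓝 (∑ n ∈ Finset.range N, coeff (k / s) (c + 1) cs n)) := by
      refine tendsto_finsetSum _ fun n _ => ?_
      simpa using (hx.pow n).const_mul (coeff (k / s) (c + 1) cs n)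
    refine le_of_tendsto_of_tendsto h1 ht ?_
    filter_upwards [eventually_nhdsGT_zero_mem_Ioo] with y hy
    have hxy := one_sub_pow_mem_Ioo hs hy
    exact (summable_of_abs_le_succ_pow (abs_coeff_le hp hp1 _ _)
      (by rw [abs_of_pos hxy.1]; exact hxy.2)).sum_le_tsum _
      fun n _ => mul_nonneg (coeff_nonneg hp _ _ n) (pow_nonneg hxy.1.le n)
  have hx' : Tendsto (fun y : ℝ => 1 - y ^ s) (𝓝[>] 0) (𝓝[<] 1) := by
    refine tendsto_nhdsWithin_iff.2 ⟨hx, ?_⟩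
    filter_upwards [eventually_nhdsGT_zero_mem_Ioo] with y hy using (one_sub_pow_mem_Ioo hs hy).2
  have habel := (Real.tendsto_tsum_powerSeries_nhdsWithin_lt
    hsum.hasSum.tendsto_sum_nat).comp hx'
  exact ⟨L, hL, tendsto_nhds_unique habel ht ▸ hsum.hasSum⟩

/-! ### Series with rational weights -/

lemma ratCast_mem_polylogAlgebra (r : ℚ) : (r : ℝ) ∈ polylogAlgebra :=
  Subalgebra.algebraMap_mem _ r

lemma multipleHarmonicSum_mem (cs : List ℕ) (n : ℕ) : multipleHarmonicSum cs n ∈ polylogAlgebra := by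
  induction cs generalizing n with
  | nil => simp [multipleHarmonicSum]
  | cons c cs ih =>
    rw [multipleHarmonicSum]
    refine sum_mem fun i _ => mul_mem ?_ (ih i)
    have := ratCast_mem_polylogAlgebra (1 / (i : ℚ) ^ c)
    push_cast at this
    exact this

lemma pochRatio_mem (p : ℚ) (n : ℕ) : pochRatio p n ∈ polylogAlgebra := by
  induction n with
  | zero => rw [pochRatio_zero]; exact one_mem _
  | succ n ih =>
    rw [pochRatio_succ]
    refine mul_mem ?_ ih
    have := ratCast_mem_polylogAlgebra ((n + p) / (n + 1))
    push_cast at this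
    exact this

/-- The series `∑ (p)_n / n! * S_{cs}(n) * f(n)` converges, and its value is a polynomial expression
in cyclotomic polylogarithms at one. -/
def HasPolylogSum (p : ℚ) (cs : List ℕ) (f : ℕ → ℚ) : Prop :=
  ∃ L ∈ polylogAlgebra,
    HasSum (fun n => pochRatio p n * multipleHarmonicSum cs n * (f n : ℝ)) L

lemma HasPolylogSum.add {p : ℚ} {cs : List ℕ} {f g : ℕ → ℚ} (hf : HasPolylogSum p cs f)
    (hg : HasPolylogSum p cs g) : HasPolylogSum p cs fun n => f n + g n := by
  obtain ⟨L, hL, h1⟩ := hf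
  obtain ⟨K, hK, h2⟩ := hg
  exact ⟨L + K, add_mem hL hK, (h1.add h2).congr_fun fun n => by push_cast; ring⟩

lemma HasPolylogSum.const_mul {p : ℚ} {cs : List ℕ} {f : ℕ → ℚ} (hf : HasPolylogSum p cs f)
    (r : ℚ) : HasPolylogSum p cs fun n => r * f n := by
  obtain ⟨L, hL, h1⟩ := hf
  exact ⟨r * L, mul_mem (ratCast_mem_polylogAlgebra r) hL,
    (h1.mul_left (r : ℝ)).congr_fun fun n => by push_cast; ring⟩

lemma HasPolylogSum.sub {p : ℚ} {cs : List ℕ} {f g : ℕ → ℚ} (hf : HasPolylogSum p cs f)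
    (hg : HasPolylogSum p cs g) : HasPolylogSum p cs fun n => f n - g n := by
  have := hf.add (hg.const_mul (-1))
  simpa [sub_eq_add_neg] using this

/-- Changing finitely many terms changes the value by a rational number. -/
lemma HasPolylogSum.congr {p : ℚ} {cs : List ℕ} {f g : ℕ → ℚ} (hf : HasPolylogSum p cs f)
    (h : f =ᶠ[atTop] g) : HasPolylogSum p cs g := by
  obtain ⟨N, hN⟩ := eventually_atTop.1 h
  obtain ⟨L, hL, h1⟩ := hf
  have h2 : HasSum (fun n => pochRatio p n * multipleHarmonicSum cs n * ((g n - f n : ℚ) : ℝ))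
      (∑ n ∈ Finset.range N, pochRatio p n * multipleHarmonicSum cs n * ((g n - f n : ℚ) : ℝ)) := by
    refine hasSum_sum_of_ne_finset_zero fun n hn => ?_
    rw [hN n (by simpa using hn), sub_self, Rat.cast_zero, mul_zero]
  refine ⟨_, add_mem hL (sum_mem fun n _ => mul_mem (mul_mem (pochRatio_mem p n)
    (multipleHarmonicSum_mem cs n)) (ratCast_mem_polylogAlgebra _)), (h1.add h2).congr_fun fun n => ?_⟩
  push_cast
  ring

/-- A convergent sequence `u` with `∑ u n / n` summable tends to zero. -/
lemma eq_zero_of_summable_div {u : ℕ → ℝ} {l : ℝ} (hu : Tendsto u atTop (𝓝 l))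
    (hs : Summable fun n => u n / n) : l = 0 := by
  by_contra hl
  have h1 : (fun _ : ℕ => (1 : ℝ)) =O[atTop] u :=
    isBigO_const_left_iff_pos_le_norm one_ne_zero |>.2 (by
      have h2 := hu.norm
      have h3 : 0 < ‖l‖ := norm_pos_iff.2 hl
      exact ⟨‖l‖ / 2, by positivity,
        h2.eventually (eventually_ge_nhds (by linarith : ‖l‖ / 2 < ‖l‖))⟩)
  have h2 : (fun n : ℕ => (1 : ℝ) / n) =O[atTop] fun n => u n / n := by
    simpa [div_eq_mul_inv] using h1.mul (isBigO_refl (fun n : ℕ => ((n : ℝ))⁻¹) atTop)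
  exact Real.not_summable_one_div_natCast (summable_of_isBigO_nat' hs h2)

/-- Summation by parts. The difference `g(n) - (n + p) / (n + 1) * g(n + 1)` is chosen so that it
telescopes against `(p)_n / n!`; what remains is a series in which the first index of the multiple
harmonic sum has disappeared. -/
lemma HasPolylogSum.telescope {p : ℚ} {cs : List ℕ} {g : ℕ → ℚ}
    (hrest : ∀ c ds, cs = c :: ds → HasPolylogSum p ds fun n => g n / (n : ℚ) ^ c)
    (hsum : Summable fun n => pochRatio p n * multipleHarmonicSum cs n *
      ((g n - (n + p) / (n + 1) * g (n + 1) : ℚ) : ℝ))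
    (hbd : Summable fun n => pochRatio p n * multipleHarmonicSum cs n * (g n : ℝ) / n) :
    HasPolylogSum p cs fun n => g n - (n + p) / (n + 1) * g (n + 1) := by
  set u : ℕ → ℝ := fun n => pochRatio p n * multipleHarmonicSum cs n * (g n : ℝ) with hu
  -- the terms in which the first index of the harmonic sum equals `n`
  obtain ⟨w, W, hW, hw, hrec⟩ : ∃ w : ℕ → ℝ, ∃ W ∈ polylogAlgebra, HasSum w W ∧
      ∀ n, pochRatio p n * multipleHarmonicSum cs n *
        ((g n - (n + p) / (n + 1) * g (n + 1) : ℚ) : ℝ) = u n - u (n + 1) + w n := by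
    rcases cs with _ | ⟨c, ds⟩
    · refine ⟨fun _ => 0, 0, zero_mem _, hasSum_zero, fun n => ?_⟩
      simp only [hu, multipleHarmonicSum]
      rw [pochRatio_succ]
      push_cast
      ring
    · obtain ⟨W, hW, hs⟩ := hrest c ds rfl
      have hs' := (hasSum_nat_add_iff' 1).2 hs
      refine ⟨_, _, sub_mem hW (sum_mem fun n _ => ?_), hs', fun n => ?_⟩
      · exact mul_mem (mul_mem (pochRatio_mem p n) (multipleHarmonicSum_mem ds n))
          (ratCast_mem_polylogAlgebra _)
      · simp only [hu]
        rw [multipleHarmonicSum_succ, pochRatio_succ]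
        push_cast
        ring
  have hpart : ∀ N, ∑ n ∈ Finset.range N, pochRatio p n * multipleHarmonicSum cs n *
      ((g n - (n + p) / (n + 1) * g (n + 1) : ℚ) : ℝ)
        = u 0 - u N + ∑ n ∈ Finset.range N, w n := by
    intro N
    rw [Finset.sum_congr rfl fun n _ => hrec n, Finset.sum_add_distrib, Finset.sum_range_sub']
  have hlim : Tendsto u atTop (𝓝 (u 0 + W - ∑' n, pochRatio p n * multipleHarmonicSum cs n *
      ((g n - (n + p) / (n + 1) * g (n + 1) : ℚ) : ℝ))) := by
    have := (hw.tendsto_sum_nat.const_add (u 0)).sub hsum.hasSum.tendsto_sum_nat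
    refine this.congr fun N => ?_
    rw [hpart]; ring
  have h0 := eq_zero_of_summable_div hlim hbd
  refine ⟨u 0 + W, add_mem (mul_mem (mul_mem (pochRatio_mem p 0) (multipleHarmonicSum_mem cs 0))
    (ratCast_mem_polylogAlgebra _)) hW, ?_⟩
  rw [sub_eq_zero.1 h0]
  exact hsum.hasSum

/-! ### Products of linear denominators -/

/-- The product of the fractions `1 / (n + b)` for `b` in a multiset of integers (a factor with
`n + b = 0` counts as `0`). -/
def linFrac (l : Multiset ℤ) (n : ℕ) : ℚ := (l.map fun b : ℤ => ((n : ℚ) + b)⁻¹).prod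

lemma linFrac_cons (b : ℤ) (l : Multiset ℤ) (n : ℕ) :
    linFrac (b ::ₘ l) n = ((n : ℚ) + b)⁻¹ * linFrac l n := by simp [linFrac]

lemma linFrac_add (l m : Multiset ℤ) (n : ℕ) : linFrac (l + m) n = linFrac l n * linFrac m n := by
  simp [linFrac]

lemma linFrac_replicate (c : ℕ) (b : ℤ) (n : ℕ) :
    linFrac (Multiset.replicate c b) n = (((n : ℚ) + b) ^ c)⁻¹ := by simp [linFrac]

lemma linFrac_succ (c : ℕ) (b : ℤ) (n : ℕ) :
    linFrac (Multiset.replicate c b) (n + 1) = linFrac (Multiset.replicate c (b + 1)) n := by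
  rw [linFrac_replicate, linFrac_replicate]
  push_cast
  ring_nf

lemma eventually_add_intCast_ne_zero (b : ℤ) : ∀ᶠ n : ℕ in atTop, (n : ℚ) + b ≠ 0 := by
  filter_upwards [eventually_gt_atTop b.natAbs] with n hn
  have : (n : ℤ) + b ≠ 0 := by omega
  exact_mod_cast this

lemma isBigO_linFrac (l : Multiset ℤ) :
    (fun n => (linFrac l n : ℝ)) =O[atTop] fun n : ℕ => ((n : ℝ) ^ Multiset.card l)⁻¹ := by
  induction l using Multiset.induction with
  | empty => simpa [linFrac] using isBigO_refl (fun _ : ℕ => (1 : ℝ)) atTop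
  | cons b l ih =>
    have h : (fun n : ℕ => ((n : ℝ) + b)⁻¹) =O[atTop] fun n : ℕ => ((n : ℝ))⁻¹ := by
      refine IsBigO.of_bound 2 ?_
      filter_upwards [eventually_gt_atTop (2 * b.natAbs)] with n hn
      have h1 : (2 * |(b : ℝ)|) < n := by
        have h2 : ((2 * b.natAbs : ℕ) : ℝ) < n := by exact_mod_cast hn
        rwa [Nat.cast_mul, Nat.cast_natAbs, Int.cast_abs, Nat.cast_ofNat] at h2
      have h2 := neg_abs_le (b : ℝ)
      have h3 := abs_nonneg (b : ℝ)
      have h4 : (0 : ℝ) < n := by linarith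
      have h5 : (0 : ℝ) < n + b := by linarith
      rw [Real.norm_of_nonneg (by positivity), Real.norm_of_nonneg (by positivity), ← div_eq_mul_inv,
        inv_eq_one_div, div_le_div_iff₀ h5 h4]
      linarith
    refine (h.mul ih).congr (fun n => ?_) (fun n => ?_)
    · rw [linFrac_cons]; push_cast; rfl
    · rw [Multiset.card_cons, pow_succ', mul_inv]

lemma linFrac_cons_cons {b b' : ℤ} (h : b ≠ b') (l : Multiset ℤ) :
    (fun n => ((b : ℚ) - b')⁻¹ * (linFrac (b' ::ₘ l) n - linFrac (b ::ₘ l) n))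
      =ᶠ[atTop] linFrac (b ::ₘ b' ::ₘ l) := by
  filter_upwards [eventually_add_intCast_ne_zero b, eventually_add_intCast_ne_zero b'] with n h1 h2
  have h3 : (b : ℚ) - b' ≠ 0 := sub_ne_zero.2 (by exact_mod_cast h)
  simp only [linFrac_cons]
  field_simp
  ring

/-- Partial fractions: it suffices to treat the powers of a single linear factor and the products
of the least admissible number of factors. -/
lemma hasPolylogSum_linFrac_of {p : ℚ} {cs : List ℕ} {κ : ℕ}
    (hpow : ∀ b c, κ ≤ c → HasPolylogSum p cs (linFrac (Multiset.replicate c b)))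
    (hmin : ∀ l, Multiset.card l = κ → HasPolylogSum p cs (linFrac l)) (l : Multiset ℤ)
    (hl : κ ≤ Multiset.card l) : HasPolylogSum p cs (linFrac l) := by
  induction hm : Multiset.card l generalizing l with
  | zero => exact hmin l (by omega)
  | succ m ih =>
    rcases hl.eq_or_lt with h | h
    · exact hmin l h.symm
    obtain ⟨b, hb⟩ := Multiset.exists_mem_of_ne_zero (s := l) (by rintro rfl; simp at hm)
    by_cases hall : ∀ b' ∈ l, b' = b
    · rw [Multiset.eq_replicate_card.2 hall]
      exact hpow b _ hl
    · push Not at hall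
      obtain ⟨b', hb', hne⟩ := hall
      obtain ⟨l1, rfl⟩ := Multiset.exists_cons_of_mem hb
      obtain ⟨l2, rfl⟩ := Multiset.exists_cons_of_mem
        ((Multiset.mem_cons.1 hb').resolve_left hne)
      simp only [Multiset.card_cons] at hm h
      exact (((ih _ (by simp; omega) (by simpa using by omega)).sub
        (ih _ (by simp; omega) (by simpa using by omega))).const_mul _).congr
        (linFrac_cons_cons hne.symm l2)

section

variable {k s : ℕ} {p : ℚ}

lemma hasPolylogSum_pow_zero (hk : 0 < k) (hks : k ≤ s) (hp : p = k / s) {cs : List ℕ}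
    (hcs : ∀ c ∈ cs, 1 ≤ c) (c : ℕ) (hc : c ≠ 0 ∨ k < s) :
    HasPolylogSum p cs (linFrac (Multiset.replicate (c + 1) 0)) := by
  obtain ⟨L, hL, h⟩ := exists_hasSum_coeff hk hks cs hcs c hc
  refine ⟨L, hL, h.congr_fun fun n => ?_⟩
  rw [linFrac_replicate, coeff, hp]
  push_cast
  rw [add_zero, ← div_eq_mul_inv]

lemma summable_mul_of_isBigO (hk : 0 < k) (hks : k ≤ s) (hp : p = k / s) {cs : List ℕ}
    (hcs : ∀ c ∈ cs, 1 ≤ c) (c : ℕ) (hc : c ≠ 0 ∨ k < s) {f : ℕ → ℝ}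
    (hf : f =O[atTop] fun n : ℕ => ((n : ℝ) ^ (c + 1))⁻¹) :
    Summable fun n => pochRatio p n * multipleHarmonicSum cs n * f n := by
  obtain ⟨L, -, h⟩ := hasPolylogSum_pow_zero hk hks hp hcs c hc
  refine summable_of_isBigO_nat' h.summable ((isBigO_refl _ _).mul (hf.congr_right fun n => ?_))
  rw [linFrac_replicate]
  push_cast
  rw [add_zero]

end

lemma isBigO_linFrac_of_le {l : Multiset ℤ} {m : ℕ} (h : m ≤ Multiset.card l) :
    (fun n => (linFrac l n : ℝ)) =O[atTop] fun n : ℕ => ((n : ℝ) ^ m)⁻¹ := by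
  refine (isBigO_linFrac l).trans (IsBigO.of_bound 1 ?_)
  filter_upwards [eventually_ge_atTop 1] with n hn
  have h1 : (1 : ℝ) ≤ n := by exact_mod_cast hn
  rw [Real.norm_of_nonneg (by positivity), Real.norm_of_nonneg (by positivity), one_mul]
  exact inv_anti₀ (by positivity) (pow_le_pow_right₀ h1 h)

/-- The division `n = (n + b) - b`. -/
lemma eventually_mul_linFrac_succ (c : ℕ) (b : ℤ) :
    ∀ᶠ n : ℕ in atTop, (n : ℚ) * linFrac (Multiset.replicate (c + 1) b) n
      = linFrac (Multiset.replicate c b) n - b * linFrac (Multiset.replicate (c + 1) b) n := by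
  filter_upwards [eventually_add_intCast_ne_zero b] with n hn
  simp only [linFrac_replicate]
  rw [pow_succ, mul_inv]
  field_simp
  ring

section

variable {k s : ℕ} {p : ℚ}

/-- For `p < 1`, summation by parts with `g(n) = n / (n + b) ^ (c + 1)` relates the powers of
`n + b` and `n + b + 1` in the denominator. -/
lemma hasPolylogSum_shift (hk : 0 < k) (hks : k < s) (hp : p = k / s) {cs : List ℕ}
    (hcs : ∀ c ∈ cs, 1 ≤ c)
    (hrest : ∀ c ds, cs = c :: ds → ∀ l, 1 ≤ Multiset.card l → HasPolylogSum p ds (linFrac l))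
    (b : ℤ) (c : ℕ)
    (hprev : c ≠ 0 → ∀ b, HasPolylogSum p cs (linFrac (Multiset.replicate c b))) :
    HasPolylogSum p cs fun n => b * linFrac (Multiset.replicate (c + 1) b) n
      + (p - (b + 1)) * linFrac (Multiset.replicate (c + 1) (b + 1)) n := by
  set R : ℕ → ℤ → ℕ → ℚ := fun c b => linFrac (Multiset.replicate c b) with hR
  set g : ℕ → ℚ := fun n => n * R (c + 1) b n with hg
  have hdiff : HasPolylogSum p cs fun n => R c b n - R c (b + 1) n := by
    by_cases hc : c = 0
    · subst hc
      exact ⟨0, zero_mem _, by simp [hR, linFrac]⟩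
    · exact (hprev hc b).sub (hprev hc (b + 1))
  have hf : (fun n => g n - (n + p) / (n + 1) * g (n + 1)) =ᶠ[atTop]
      fun n => (R c b n - R c (b + 1) n) -
        (b * R (c + 1) b n + (p - (b + 1)) * R (c + 1) (b + 1) n) := by
    filter_upwards [eventually_mul_linFrac_succ c b, eventually_mul_linFrac_succ c (b + 1)]
      with n h1 h2
    have hn : (n : ℚ) + 1 ≠ 0 := by positivity
    have h3 : (n + p) / ((n : ℚ) + 1) * g (n + 1)
        = n * R (c + 1) (b + 1) n + p * R (c + 1) (b + 1) n := by
      simp only [hg, hR, linFrac_succ]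
      push_cast
      field_simp
    rw [h3]
    simp only [hg, hR]
    rw [h1, h2]
    push_cast
    ring
  have hO : ∀ b, (fun n => (R (c + 1) b n : ℝ)) =O[atTop] fun n : ℕ => ((n : ℝ) ^ (0 + 1))⁻¹ :=
    fun b => isBigO_linFrac_of_le (by simp)
  have hO' : (fun n => ((R c b n - R c (b + 1) n : ℚ) : ℝ)) =O[atTop]
      fun n : ℕ => ((n : ℝ) ^ (0 + 1))⁻¹ := by
    by_cases hc : c = 0
    · subst hc
      simpa [hR, linFrac] using isBigO_zero _ _
    · push_cast
      exact (isBigO_linFrac_of_le (by simp; omega)).sub (isBigO_linFrac_of_le (by simp; omega))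
  have hmain := HasPolylogSum.telescope (p := p) (cs := cs) (g := g) ?_ ?_ ?_
  · refine (hdiff.sub (hmain.congr hf)).congr (Eventually.of_forall fun n => ?_)
    exact sub_sub_cancel _ _
  · rintro c1 ds rfl
    obtain ⟨e, rfl⟩ : ∃ e, c1 = e + 1 := ⟨c1 - 1, by have := hcs c1 (by simp); omega⟩
    refine (hrest _ ds rfl (Multiset.replicate (c + 1) b + Multiset.replicate e 0)
      (by simp)).congr ?_
    filter_upwards [eventually_ge_atTop 1] with n hn
    have h0 : (n : ℚ) ≠ 0 := by positivity
    rw [linFrac_add, linFrac_replicate e]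
    simp only [hg, hR]
    push_cast
    rw [add_zero, pow_succ]
    field_simp
  · refine summable_mul_of_isBigO hk hks.le hp hcs 0 (Or.inr hks) ?_
    have : (fun n => ((g n - (n + p) / (n + 1) * g (n + 1) : ℚ) : ℝ)) =ᶠ[atTop]
        fun n => ((R c b n - R c (b + 1) n : ℚ) : ℝ) -
          (b * (R (c + 1) b n : ℝ) + (p - (b + 1)) * (R (c + 1) (b + 1) n : ℝ)) := by
      filter_upwards [hf] with n hn
      rw [hn]
      push_cast
      ring
    exact this.trans_isBigO
      (hO'.sub (((hO b).const_mul_left _).add ((hO (b + 1)).const_mul_left _)))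
  · simp only [mul_div_assoc]
    refine summable_mul_of_isBigO hk hks.le hp hcs 0 (Or.inr hks) ?_
    refine EventuallyEq.trans_isBigO ?_ (hO b)
    filter_upwards [eventually_ge_atTop 1] with n hn
    have h0 : (n : ℝ) ≠ 0 := by positivity
    simp only [hg]
    push_cast
    field_simp

/-- For `p = 1` the factor `(p)_n / n!` is trivial, and a shift of the summation index changes the
value only by sums of smaller depth. -/
lemma hasPolylogSum_sub_shift (hk : 0 < k) (hp : p = 1) {cs : List ℕ} (hcs : ∀ c ∈ cs, 1 ≤ c)
    (hrest : ∀ c ds, cs = c :: ds → ∀ l, 2 ≤ Multiset.card l → HasPolylogSum p ds (linFrac l))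
    (b : ℤ) (c : ℕ) :
    HasPolylogSum p cs fun n => linFrac (Multiset.replicate (c + 1) b) n
      - linFrac (Multiset.replicate (c + 1) (b + 1)) n := by
  have hp' : p = k / k := by rw [hp, div_self (by positivity)]
  set R : ℕ → ℤ → ℕ → ℚ := fun c b => linFrac (Multiset.replicate c b) with hR
  have hf : ∀ n : ℕ, R (c + 1) b n - (n + p) / (n + 1) * R (c + 1) b (n + 1)
      = R (c + 1) b n - R (c + 1) (b + 1) n := by
    intro n
    rw [hp, div_self (by positivity), one_mul]
    simp only [hR, linFrac_succ]
  have hO : (fun n => ((R (c + 1) b n - R (c + 1) (b + 1) n : ℚ) : ℝ)) =O[atTop]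
      fun n : ℕ => ((n : ℝ) ^ (1 + 1))⁻¹ := by
    by_cases hc : c = 0
    · subst hc
      refine EventuallyEq.trans_isBigO ?_ (isBigO_linFrac_of_le
        (l := (b + 1) ::ₘ b ::ₘ 0) (by simp))
      filter_upwards [linFrac_cons_cons (show b + 1 ≠ b by omega) 0] with n hn
      rw [← hn]
      simp [hR]
    · push_cast
      exact (isBigO_linFrac_of_le (by simp; omega)).sub (isBigO_linFrac_of_le (by simp; omega))
  have hmain := HasPolylogSum.telescope (p := p) (cs := cs) (g := R (c + 1) b) ?_ ?_ ?_
  · simpa only [hf] using hmain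
  · rintro c1 ds rfl
    have h1 := hcs c1 (by simp)
    refine (hrest _ ds rfl (Multiset.replicate (c + 1) b + Multiset.replicate c1 0)
      (by simp; omega)).congr (Eventually.of_forall fun n => ?_)
    rw [linFrac_add, linFrac_replicate c1]
    simp [hR, div_eq_mul_inv]
  · simp only [hf]
    exact summable_mul_of_isBigO hk le_rfl hp' hcs 1 (by simp) hO
  · simp only [mul_div_assoc]
    refine summable_mul_of_isBigO hk le_rfl hp' hcs 1 (by simp) ?_
    have := (isBigO_linFrac_of_le (l := Multiset.replicate (c + 1) b) (m := 1) (by simp)).mul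
      (isBigO_refl (fun n : ℕ => ((n : ℝ))⁻¹) atTop)
    refine this.congr (fun n => (div_eq_mul_inv _ _).symm) fun n => ?_
    rw [pow_one, pow_two, mul_inv]

lemma hasPolylogSum_linFrac_of_lt (hk : 0 < k) (hks : k < s) (hp : p = k / s) {cs : List ℕ}
    (hcs : ∀ c ∈ cs, 1 ≤ c)
    (hrest : ∀ c ds, cs = c :: ds → ∀ l, 1 ≤ Multiset.card l → HasPolylogSum p ds (linFrac l))
    (l : Multiset ℤ) (hl : 1 ≤ Multiset.card l) : HasPolylogSum p cs (linFrac l) := by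
  have hs : (0 : ℚ) < s := by exact_mod_cast hk.trans hks
  have hp0 : 0 < p := by rw [hp]; positivity
  have hp1 : p < 1 := by rw [hp, div_lt_one hs]; exact_mod_cast hks
  -- the recurrence propagates from `b = 0` in both directions, because `b` and `p - (b + 1)` do not
  -- vanish for `b < 0` and `b ≥ 0`, respectively
  have hstep : ∀ c : ℕ,
      (c ≠ 0 → ∀ b, HasPolylogSum p cs (linFrac (Multiset.replicate c b))) →
      ∀ b, HasPolylogSum p cs (linFrac (Multiset.replicate (c + 1) b)) := by
    intro c hprev b
    have hrel := fun b => hasPolylogSum_shift hk hks hp hcs hrest b c hprev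
    induction b using Int.induction_on with
    | zero => exact hasPolylogSum_pow_zero hk hks.le hp hcs c (Or.inr hks)
    | succ i ih =>
      have hne : p - ((i : ℤ) + 1) ≠ 0 := by
        have : (0 : ℚ) ≤ i := by positivity
        push_cast
        linarith
      refine (((hrel i).sub (ih.const_mul ((i : ℤ) : ℚ))).const_mul (p - ((i : ℤ) + 1))⁻¹).congr
        (Eventually.of_forall fun n => ?_)
      simp only [add_sub_cancel_left, inv_mul_cancel_left₀ hne]
    | pred i ih =>
      have hne : ((-(i : ℤ) - 1 : ℤ) : ℚ) ≠ 0 := by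
        have : (0 : ℚ) ≤ i := by positivity
        push_cast
        linarith
      have h := hrel (-(i : ℤ) - 1)
      rw [sub_add_cancel] at h
      refine ((h.sub (ih.const_mul (p - (((-(i : ℤ) - 1 : ℤ) : ℚ) + 1)))).const_mul
        (((-(i : ℤ) - 1 : ℤ) : ℚ))⁻¹).congr (Eventually.of_forall fun n => ?_)
      simp only [add_sub_cancel_right, inv_mul_cancel_left₀ hne]
  have hpow : ∀ c b, HasPolylogSum p cs (linFrac (Multiset.replicate (c + 1) b)) := by
    intro c
    induction c with
    | zero => exact hstep 0 fun h => absurd rfl h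
    | succ c ih => exact hstep (c + 1) fun _ => ih
  refine hasPolylogSum_linFrac_of (κ := 1) (fun b c hc => ?_) (fun l hl => ?_) l hl
  · obtain ⟨c, rfl⟩ : ∃ e, c = e + 1 := ⟨c - 1, by omega⟩
    exact hpow c b
  · obtain ⟨b, rfl⟩ := Multiset.card_eq_one.1 hl
    exact hpow 0 b

lemma hasPolylogSum_linFrac_one (hk : 0 < k) (hp : p = 1) {cs : List ℕ}
    (hcs : ∀ c ∈ cs, 1 ≤ c)
    (hrest : ∀ c ds, cs = c :: ds → ∀ l, 2 ≤ Multiset.card l → HasPolylogSum p ds (linFrac l))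
    (l : Multiset ℤ) (hl : 2 ≤ Multiset.card l) : HasPolylogSum p cs (linFrac l) := by
  have hp' : p = k / k := by rw [hp, div_self (by positivity)]
  have hrel := fun b c => hasPolylogSum_sub_shift hk hp hcs hrest b c
  have hpow : ∀ c b, HasPolylogSum p cs (linFrac (Multiset.replicate (c + 1 + 1) b)) := by
    intro c b
    induction b using Int.induction_on with
    | zero => exact hasPolylogSum_pow_zero hk le_rfl hp' hcs (c + 1) (by simp)
    | succ i ih =>
      refine (ih.sub (hrel i (c + 1))).congr (Eventually.of_forall fun n => ?_)
      exact sub_sub_cancel _ _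
    | pred i ih =>
      have h := hrel (-(i : ℤ) - 1) (c + 1)
      rw [sub_add_cancel] at h
      refine (h.add ih).congr (Eventually.of_forall fun n => ?_)
      exact sub_add_cancel _ _
  have hdist : ∀ (m : ℕ) (b : ℤ), HasPolylogSum p cs fun n => linFrac (Multiset.replicate 1 b) n
      - linFrac (Multiset.replicate 1 (b + m)) n := by
    intro m b
    induction m with
    | zero => exact ⟨0, zero_mem _, by simp⟩
    | succ m ih =>
      refine (ih.add (hrel (b + m) 0)).congr (Eventually.of_forall fun n => ?_)
      rw [Nat.cast_succ, ← add_assoc]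
      exact sub_add_sub_cancel _ _ _
  have hpair : ∀ x y : ℤ, x < y → HasPolylogSum p cs (linFrac (y ::ₘ x ::ₘ 0)) := by
    intro x y hxy
    obtain ⟨m, rfl⟩ : ∃ m : ℕ, y = x + m := ⟨(y - x).toNat, by omega⟩
    exact ((hdist m x).const_mul _).congr (linFrac_cons_cons hxy.ne' 0)
  refine hasPolylogSum_linFrac_of (κ := 2) (fun b c hc => ?_) (fun l hl => ?_) l hl
  · obtain ⟨c, rfl⟩ : ∃ e, c = e + 1 + 1 := ⟨c - 2, by omega⟩
    exact hpow c b
  · obtain ⟨x, y, rfl⟩ := Multiset.card_eq_two.1 hl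
    rcases lt_trichotomy x y with h | rfl | h
    · have := hpair x y h
      rwa [Multiset.cons_swap] at this
    · exact hpow 0 x
    · exact hpair y x h

/-- All products of at least one linear denominator for `p < 1`, and of at least two for `p = 1`. -/
lemma hasPolylogSum_linFrac (hk : 0 < k) (hp : p = k / s) {κ : ℕ}
    (hκ : κ = 1 ∧ k < s ∨ κ = 2 ∧ k = s) {cs : List ℕ} (hcs : ∀ c ∈ cs, 1 ≤ c) (l : Multiset ℤ)
    (hl : κ ≤ Multiset.card l) : HasPolylogSum p cs (linFrac l) := by
  have hmain : ∀ cs : List ℕ, (∀ c ∈ cs, 1 ≤ c) →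
      (∀ c ds, cs = c :: ds → ∀ l, κ ≤ Multiset.card l → HasPolylogSum p ds (linFrac l)) →
      ∀ l, κ ≤ Multiset.card l → HasPolylogSum p cs (linFrac l) := by
    rcases hκ with ⟨rfl, hks⟩ | ⟨rfl, rfl⟩
    · exact fun cs hcs hrest => hasPolylogSum_linFrac_of_lt hk hks hp hcs hrest
    · exact fun cs hcs hrest =>
        hasPolylogSum_linFrac_one hk (hp.trans (div_self (by positivity))) hcs hrest
  induction cs generalizing l with
  | nil => exact hmain [] hcs (by simp) l hl
  | cons c cs ih =>
    refine hmain _ hcs (fun c' ds h l hl => ?_) l hl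
    obtain ⟨-, rfl⟩ := List.cons.inj h
    exact ih (fun c hc => hcs c (by simp [hc])) l hl

end

/-! ### The rational weight of the series -/

/-- The rational function `n! / ((n + b) ^ c * (n + d)!)` of `n`. It has the intended value once
`n + d ≥ 0` and `n + b ≠ 0`. -/
def weight (b d : ℤ) (c n : ℕ) : ℚ :=
  (n.factorial : ℚ) / (((n : ℚ) + b) ^ c * (((n : ℤ) + d).toNat.factorial : ℚ))

lemma exists_linFrac_eq_factorial_div (d : ℕ) :
    ∃ l : Multiset ℤ, Multiset.card l = d ∧
      ∀ n : ℕ, (n.factorial : ℚ) / ((n + d).factorial : ℚ) = linFrac l n := by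
  induction d with
  | zero =>
    exact ⟨0, rfl, fun n => by simp [linFrac, n.factorial_ne_zero]⟩
  | succ d ih =>
    obtain ⟨l, hl, h⟩ := ih
    refine ⟨((d + 1 : ℕ) : ℤ) ::ₘ l, by simp [hl], fun n => ?_⟩
    have h1 : (n : ℚ) + (d + 1) ≠ 0 := by positivity
    rw [linFrac_cons, ← h, ← add_assoc, Nat.factorial_succ]
    push_cast
    rw [add_assoc]
    field_simp

lemma exists_weight_eq (b d : ℤ) (c : ℕ) :
    ∃ e l, (Multiset.card l : ℤ) = c + d + (e : ℕ) ∧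
      (fun n => (n.descFactorial e : ℚ) * linFrac l n) =ᶠ[atTop] weight b d c := by
  rcases le_total 0 d with hd | hd
  · obtain ⟨d, rfl⟩ := Int.eq_ofNat_of_zero_le hd
    obtain ⟨l, hl, h⟩ := exists_linFrac_eq_factorial_div d
    refine ⟨0, Multiset.replicate c b + l, by simp [hl], Eventually.of_forall fun n => ?_⟩
    have : ((n : ℤ) + (d : ℤ)).toNat = n + d := by omega
    simp only [Nat.descFactorial_zero, Nat.cast_one, one_mul]
    rw [weight, linFrac_add, linFrac_replicate, ← h, this]
    field_simp
  · obtain ⟨e, rfl⟩ : ∃ e : ℕ, d = -e := ⟨(-d).toNat, by omega⟩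
    refine ⟨e, Multiset.replicate c b, by simp, ?_⟩
    filter_upwards [eventually_ge_atTop e] with n hn
    have h1 : ((n : ℤ) + -(e : ℤ)).toNat = n - e := by omega
    have h2 : ((n - e).factorial : ℚ) ≠ 0 := Nat.cast_ne_zero.2 (Nat.factorial_ne_zero _)
    rw [weight, linFrac_replicate, h1, ← Nat.factorial_mul_descFactorial hn]
    push_cast
    field_simp

/-- Each linear factor in the numerator can be written in terms of a denominator, at the price of
lowering the number of denominators by one. -/
lemma hasPolylogSum_descFactorial_mul {p : ℚ} {cs : List ℕ} {κ : ℕ}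
    (h : ∀ l, κ ≤ Multiset.card l → HasPolylogSum p cs (linFrac l)) (e : ℕ) (l : Multiset ℤ)
    (hl : κ + e ≤ Multiset.card l) :
    HasPolylogSum p cs fun n => (n.descFactorial e : ℚ) * linFrac l n := by
  induction e generalizing l with
  | zero => simpa using h l hl
  | succ e ih =>
    obtain ⟨b, hb⟩ := Multiset.card_pos_iff_exists_mem.1 (show 0 < Multiset.card l by omega)
    obtain ⟨l, rfl⟩ := Multiset.exists_cons_of_mem hb
    rw [Multiset.card_cons] at hl
    refine ((ih l (by omega)).sub ((ih (b ::ₘ l) (by rw [Multiset.card_cons]; omega)).const_mul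
      (b + e))).congr ?_
    filter_upwards [eventually_add_intCast_ne_zero b, eventually_ge_atTop e] with n h1 h2
    rw [Nat.descFactorial_succ, linFrac_cons]
    push_cast [Nat.cast_sub h2]
    field_simp
    ring

/-- Passing from `S_{cs}(n)` to `S_{cs}(n + 1)` adds sums of smaller depth. -/
lemma exists_hasSum_of_multipleHarmonicSum_succ {p : ℚ} {κ : ℕ} {cs : List ℕ}
    (hcs : ∀ c ∈ cs, 1 ≤ c)
    (h : ∀ ds : List ℕ, (∀ c ∈ ds, 1 ≤ c) → ∀ l, κ ≤ Multiset.card l → HasPolylogSum p ds (linFrac l))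
    (e : ℕ) (l : Multiset ℤ) (hl : κ + e ≤ Multiset.card l) :
    ∃ L ∈ polylogAlgebra, HasSum (fun n => pochRatio p n * multipleHarmonicSum cs (n + 1) *
      (((n.descFactorial e : ℚ) * linFrac l n : ℚ) : ℝ)) L := by
  induction cs generalizing l with
  | nil => simpa [multipleHarmonicSum, HasPolylogSum] using hasPolylogSum_descFactorial_mul (h [] hcs) e l hl
  | cons c cs ih =>
    obtain ⟨L, hL, h1⟩ := hasPolylogSum_descFactorial_mul (h _ hcs) e l hl
    obtain ⟨K, hK, h2⟩ := ih (fun c hc => hcs c (by simp [hc])) (l + Multiset.replicate c 1)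
      (by rw [Multiset.card_add]; omega)
    refine ⟨L + K, add_mem hL hK, (h1.add h2).congr_fun fun n => ?_⟩
    rw [multipleHarmonicSum_succ, linFrac_add, linFrac_replicate]
    push_cast
    ring

/-! ### Necessity of the convergence condition -/

lemma isBigO_inv_pow_linFrac (l : Multiset ℤ) :
    (fun n : ℕ => ((n : ℝ) ^ Multiset.card l)⁻¹) =O[atTop] fun n => (linFrac l n : ℝ) := by
  induction l using Multiset.induction with
  | empty => simpa [linFrac] using isBigO_refl (fun _ : ℕ => (1 : ℝ)) atTop
  | cons b l ih =>
    have h : (fun n : ℕ => ((n : ℝ))⁻¹) =O[atTop] fun n : ℕ => ((n : ℝ) + b)⁻¹ := by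
      refine IsBigO.of_bound 2 ?_
      filter_upwards [eventually_gt_atTop b.natAbs] with n hn
      have h1 : |(b : ℝ)| < n := by
        have h2 : ((b.natAbs : ℕ) : ℝ) < n := by exact_mod_cast hn
        rwa [Nat.cast_natAbs, Int.cast_abs] at h2
      obtain ⟨h2, h3⟩ := abs_lt.1 h1
      have h4 : (0 : ℝ) < n := (abs_nonneg _).trans_lt h1
      have h5 : (0 : ℝ) < n + b := by linarith
      rw [Real.norm_of_nonneg (by positivity), Real.norm_of_nonneg (by positivity), ← div_eq_mul_inv,
        inv_eq_one_div, div_le_div_iff₀ h4 h5]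
      linarith
    refine (h.mul ih).congr (fun n => ?_) (fun n => ?_)
    · rw [Multiset.card_cons, pow_succ', mul_inv]
    · rw [linFrac_cons]; push_cast; rfl

lemma isBigO_pow_descFactorial (e : ℕ) :
    (fun n : ℕ => (n : ℝ) ^ e) =O[atTop] fun n => (n.descFactorial e : ℝ) := by
  refine IsBigO.of_bound (2 ^ e) ?_
  filter_upwards [eventually_ge_atTop (2 * e)] with n hn
  rw [Real.norm_of_nonneg (by positivity), Real.norm_of_nonneg (by positivity)]
  have h1 : (n + 1 - e) ^ e ≤ n.descFactorial e := Nat.pow_sub_le_descFactorial n e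
  have h2 : n ≤ 2 * (n + 1 - e) := by omega
  have h3 : n ^ e ≤ 2 ^ e * n.descFactorial e :=
    calc n ^ e ≤ (2 * (n + 1 - e)) ^ e := Nat.pow_le_pow_left h2 e
      _ = 2 ^ e * (n + 1 - e) ^ e := mul_pow _ _ _
      _ ≤ _ := Nat.mul_le_mul_left _ h1
  exact_mod_cast h3

lemma isBigO_inv_pow_weight {b d : ℤ} {c m : ℕ} (h : (c : ℤ) + d ≤ m) :
    (fun n : ℕ => ((n : ℝ) ^ m)⁻¹) =O[atTop] fun n => (weight b d c n : ℝ) := by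
  obtain ⟨e, l, hl, hw⟩ := exists_weight_eq b d c
  have h1 : (fun n : ℕ => ((n : ℝ) ^ m)⁻¹) =O[atTop]
      fun n : ℕ => (n : ℝ) ^ e * ((n : ℝ) ^ Multiset.card l)⁻¹ := by
    refine IsBigO.of_bound 1 ?_
    filter_upwards [eventually_ge_atTop 1] with n hn
    have h1 : (1 : ℝ) ≤ n := by exact_mod_cast hn
    rw [Real.norm_of_nonneg (by positivity), Real.norm_of_nonneg (by positivity), one_mul,
      ← div_eq_mul_inv, inv_eq_one_div, div_le_div_iff₀ (by positivity) (by positivity), one_mul,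
      ← pow_add]
    exact pow_le_pow_right₀ h1 (by omega)
  refine (h1.trans ((isBigO_pow_descFactorial e).mul (isBigO_inv_pow_linFrac l))).trans_eventuallyEq ?_
  filter_upwards [hw] with n hn
  rw [← hn]
  push_cast
  rfl

lemma eventually_weight_nonneg (b d : ℤ) (c : ℕ) : ∀ᶠ n in atTop, 0 ≤ weight b d c n := by
  filter_upwards [eventually_ge_atTop b.natAbs] with n hn
  have h1 : (0 : ℚ) ≤ (n : ℚ) + b := by
    have : (0 : ℤ) ≤ (n : ℤ) + b := by omega
    exact_mod_cast this
  rw [weight]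
  positivity

lemma summable_of_eventually_nonneg_of_tendsto {a : ℕ → ℝ} {v : ℝ} (h0 : ∀ᶠ n in atTop, 0 ≤ a n)
    (h : Tendsto (fun N => ∑ n ∈ Finset.range N, a n) atTop (𝓝 v)) : Summable a := by
  obtain ⟨N, hN⟩ := eventually_atTop.1 h0
  rw [← summable_nat_add_iff N]
  have h1 := (tendsto_add_atTop_iff_nat N).2 h
  refine ((hasSum_iff_tendsto_nat_of_nonneg (fun n => hN (n + N) (by omega))
    (v - ∑ n ∈ Finset.range N, a n)).2 ?_).summable
  refine (h1.sub_const _).congr fun M => ?_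
  rw [add_comm M N, Finset.sum_range_add, add_sub_cancel_left]
  exact Finset.sum_congr rfl fun n _ => by rw [add_comm]

lemma isBigO_inv_mul_weight {p : ℝ} (hp : 0 < p) {κ : ℕ} (hκ : κ = 1 ∨ κ = 2 ∧ p = 1) {σ : ℕ → ℝ}
    (hσ : ∀ n, 1 ≤ n → 1 ≤ σ n) {b d : ℤ} {c : ℕ} (h : (c : ℤ) + d < κ) :
    (fun n : ℕ => (1 : ℝ) / n) =O[atTop] fun n => pochRatio p n * σ n * (weight b d c n : ℝ) := by
  have hone : (fun _ : ℕ => (1 : ℝ)) =O[atTop] σ := by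
    refine IsBigO.of_bound 1 ?_
    filter_upwards [eventually_ge_atTop 1] with n hn
    rw [norm_one, one_mul]
    exact (hσ n hn).trans (le_abs_self _)
  rcases hκ with rfl | ⟨rfl, rfl⟩
  · have ht : (fun n : ℕ => (1 : ℝ) / n) =O[atTop] pochRatio p := by
      refine IsBigO.of_bound p⁻¹ ?_
      filter_upwards [eventually_ge_atTop 1] with n hn
      obtain ⟨m, rfl⟩ : ∃ m, n = m + 1 := ⟨n - 1, by omega⟩
      rw [Real.norm_of_nonneg (by positivity), Real.norm_of_nonneg (pochRatio_nonneg hp.le _),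
        inv_mul_eq_div, le_div_iff₀ hp, one_div, inv_mul_eq_div]
      exact_mod_cast div_le_pochRatio hp.le m
    have hw : (fun n : ℕ => ((n : ℝ) ^ 0)⁻¹) =O[atTop] fun n => (weight b d c n : ℝ) :=
      isBigO_inv_pow_weight (by push_cast at h ⊢; omega)
    simpa using (ht.mul hone).mul hw
  · have hw : (fun n : ℕ => ((n : ℝ) ^ 1)⁻¹) =O[atTop] fun n => (weight b d c n : ℝ) :=
      isBigO_inv_pow_weight (by push_cast at h ⊢; omega)
    simpa [pochRatio_one] using hone.mul hw

/-- The value of a convergent series for `p = k / s` in `(0, 1]`, with `S_{cs}(n)` or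
`S_{cs}(n + 1)`. Convergence forces `c + d ≥ 1`, and even `c + d ≥ 2` if `p = 1`. -/
lemma mem_polylogAlgebra_of_tendsto {k s : ℕ} (hk : 0 < k) (hks : k ≤ s) {p : ℚ} (hp : p = k / s)
    {cs : List ℕ} (hcs : ∀ c ∈ cs, 1 ≤ c) {σ : ℕ → ℝ}
    (hσ : σ = multipleHarmonicSum cs ∨ σ = fun n => multipleHarmonicSum cs (n + 1))
    {b d : ℤ} {c : ℕ} {v : ℝ}
    (hv : Tendsto (fun N => ∑ n ∈ Finset.range N, pochRatio p n * σ n * (weight b d c n : ℝ))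
      atTop (𝓝 v)) : v ∈ polylogAlgebra := by
  have hs : (0 : ℚ) < s := by exact_mod_cast hk.trans_le hks
  have hp0 : 0 < p := by rw [hp]; positivity
  obtain ⟨κ, hκ⟩ : ∃ κ, κ = 1 ∧ k < s ∨ κ = 2 ∧ k = s := by
    rcases hks.lt_or_eq with h | h
    · exact ⟨1, Or.inl ⟨rfl, h⟩⟩
    · exact ⟨2, Or.inr ⟨rfl, h⟩⟩
  have hlin : ∀ ds : List ℕ, (∀ c ∈ ds, 1 ≤ c) → ∀ l, κ ≤ Multiset.card l →
      HasPolylogSum p ds (linFrac l) := fun ds hds l hl => hasPolylogSum_linFrac hk hp hκ hds l hl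
  have hσ1 : ∀ n, 1 ≤ n → 1 ≤ σ n := by
    intro n hn
    obtain ⟨m, rfl⟩ : ∃ m, n = m + 1 := ⟨n - 1, by omega⟩
    rcases hσ with rfl | rfl <;> exact one_le_multipleHarmonicSum cs _
  by_cases hcd : (c : ℤ) + d < κ
  · exfalso
    have hκ' : κ = 1 ∨ κ = 2 ∧ (p : ℝ) = 1 := by
      rcases hκ with ⟨h, -⟩ | ⟨h, rfl⟩
      · exact Or.inl h
      · exact Or.inr ⟨h, by rw [hp, div_self hs.ne', Rat.cast_one]⟩
    have hO := isBigO_inv_mul_weight (b := b) (Rat.cast_pos.2 hp0) hκ' hσ1 hcd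
    refine Real.not_summable_one_div_natCast (summable_of_isBigO_nat'
      (summable_of_eventually_nonneg_of_tendsto ?_ hv) hO)
    filter_upwards [eventually_weight_nonneg b d c, eventually_ge_atTop 1] with n hn h1
    exact mul_nonneg (mul_nonneg (pochRatio_nonneg (by exact_mod_cast hp0.le) n)
      (zero_le_one.trans (hσ1 n h1))) (by exact_mod_cast hn)
  · obtain ⟨e, l, hl, hw⟩ := exists_weight_eq b d c
    have hle : κ + e ≤ Multiset.card l := by omega
    have hmem : ∀ n, σ n ∈ polylogAlgebra := by
      intro n
      rcases hσ with rfl | rfl <;> exact multipleHarmonicSum_mem cs _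
    obtain ⟨L, hL, hsum⟩ : ∃ L ∈ polylogAlgebra, HasSum (fun n => pochRatio p n * σ n *
        (((n.descFactorial e : ℚ) * linFrac l n : ℚ) : ℝ)) L := by
      rcases hσ with rfl | rfl
      · exact hasPolylogSum_descFactorial_mul (hlin cs hcs) e l hle
      · exact exists_hasSum_of_multipleHarmonicSum_succ hcs hlin e l hle
    obtain ⟨N, hN⟩ := eventually_atTop.1 hw
    have hfin : HasSum (fun n => pochRatio p n * σ n *
        ((weight b d c n - (n.descFactorial e : ℚ) * linFrac l n : ℚ) : ℝ))
        (∑ n ∈ Finset.range N, pochRatio p n * σ n *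
          ((weight b d c n - (n.descFactorial e : ℚ) * linFrac l n : ℚ) : ℝ)) := by
      refine hasSum_sum_of_ne_finset_zero fun n hn => ?_
      rw [← hN n (by simpa using hn), sub_self, Rat.cast_zero, mul_zero]
    have htot := (hsum.add hfin).tendsto_sum_nat
    have := tendsto_nhds_unique hv (htot.congr fun M => Finset.sum_congr rfl fun n _ => by
      push_cast; ring)
    rw [this]
    exact add_mem hL (sum_mem fun n _ => mul_mem (mul_mem (pochRatio_mem p n) (hmem n))
      (ratCast_mem_polylogAlgebra _))

/-! ### The series of the statement -/

lemma summand_eq (q b d : ℤ) (c : ℕ) (cs : List ℕ) (n : ℕ) :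
    summand q b d c cs n = if (n : ℤ) + d < 0 ∨ (c ≠ 0 ∧ (n : ℤ) + b = 0) then 0
      else pochRatio ((1 / q : ℚ) : ℝ) n * multipleHarmonicSum cs n * (weight b d c n : ℝ) := by
  rw [summand]
  split_ifs
  · rfl
  · have : (n.factorial : ℝ) ≠ 0 := Nat.cast_ne_zero.2 n.factorial_ne_zero
    rw [pochRatio, weight]
    push_cast
    field_simp

lemma summand_mem (q b d : ℤ) (c : ℕ) (cs : List ℕ) (n : ℕ) :
    summand q b d c cs n ∈ polylogAlgebra := by
  rw [summand_eq]
  split_ifs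
  · exact zero_mem _
  · exact mul_mem (mul_mem (pochRatio_mem _ n) (multipleHarmonicSum_mem cs n))
      (ratCast_mem_polylogAlgebra _)

lemma eventually_summand_eq (q b d : ℤ) (c : ℕ) (cs : List ℕ) :
    ∀ᶠ n in atTop, summand q b d c cs n
      = pochRatio ((1 / q : ℚ) : ℝ) n * multipleHarmonicSum cs n * (weight b d c n : ℝ) := by
  filter_upwards [eventually_gt_atTop (d.natAbs + b.natAbs)] with n hn
  rw [summand_eq, if_neg]
  omega

/-- Membership of the value of a series in the algebra depends only on its tail. -/
lemma mem_polylogAlgebra_of_eventuallyEq {a a' : ℕ → ℝ} (ha : ∀ n, a n ∈ polylogAlgebra)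
    (ha' : ∀ n, a' n ∈ polylogAlgebra) (h : a =ᶠ[atTop] a') {v : ℝ}
    (hv : Tendsto (fun N => ∑ n ∈ Finset.range N, a n) atTop (𝓝 v))
    (hmem : ∀ v', Tendsto (fun N => ∑ n ∈ Finset.range N, a' n) atTop (𝓝 v') →
      v' ∈ polylogAlgebra) : v ∈ polylogAlgebra := by
  obtain ⟨N, hN⟩ := eventually_atTop.1 h
  have hfin : HasSum (fun n => a' n - a n) (∑ n ∈ Finset.range N, (a' n - a n)) :=
    hasSum_sum_of_ne_finset_zero fun n hn => by rw [hN n (by simpa using hn), sub_self]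
  have h1 := hmem _ ((hv.add hfin.tendsto_sum_nat).congr fun M => by
    rw [← Finset.sum_add_distrib]
    exact Finset.sum_congr rfl fun n _ => add_sub_cancel _ _)
  exact (add_mem_cancel_right (sum_mem fun n _ => sub_mem (ha' n) (ha n))).1 h1

lemma sum_Icc_one_eq_sum_range (a : ℕ → ℝ) (N : ℕ) :
    ∑ n ∈ Finset.Icc 1 N, a n = ∑ n ∈ Finset.range N, a (n + 1) := by
  induction N with
  | zero => simp
  | succ N ih => rw [Finset.sum_Icc_succ_top (by omega), Finset.sum_range_succ, ih]

lemma succ_mul_pochRatio_succ_eq (p : ℝ) (n : ℕ) :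
    ((n : ℝ) + 1) * pochRatio p (n + 1) = p * pochRatio (p + 1) n := by
  induction n with
  | zero => simp [pochRatio_succ, pochRatio_zero]
  | succ n ih =>
    rw [succ_mul_pochRatio_succ, pochRatio_succ (p + 1), mul_left_comm p, ← ih]
    have : (n : ℝ) + 1 ≠ 0 := by positivity
    push_cast
    field_simp
    ring

lemma weight_succ (b d : ℤ) (c n : ℕ) :
    weight b d c (n + 1) = (n + 1) * weight (b + 1) (d + 1) c n := by
  have h1 : ((n + 1 : ℕ) : ℤ) + d = n + (d + 1) := by push_cast; ring
  have h2 : ((n + 1 : ℕ) : ℚ) + b = n + ((b + 1 : ℤ) : ℚ) := by push_cast; ring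
  rw [weight, weight, h1, h2, Nat.factorial_succ]
  push_cast
  ring

lemma mem_polylogAlgebra_of_pos {q b d : ℤ} (hq : 0 < q) {c : ℕ} {cs : List ℕ}
    (hcs : ∀ k ∈ cs, 1 ≤ k) {v : ℝ}
    (hv : Tendsto (fun N : ℕ => ∑ n ∈ Finset.Icc 1 N, summand q b d c cs n) atTop (𝓝 v)) :
    v ∈ polylogAlgebra := by
  have h1 : Tendsto (fun N => ∑ n ∈ Finset.range N, summand q b d c cs n) atTop
      (𝓝 (v + summand q b d c cs 0)) := by
    rw [← tendsto_add_atTop_iff_nat 1]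
    refine (hv.add_const _).congr fun N => ?_
    rw [sum_Icc_one_eq_sum_range, Finset.sum_range_succ']
  obtain ⟨s, rfl⟩ := Int.eq_ofNat_of_zero_le hq.le
  refine (add_mem_cancel_right (summand_mem (s : ℤ) b d c cs 0)).1
    (mem_polylogAlgebra_of_eventuallyEq (summand_mem _ b d c cs) (fun n => ?_)
      (eventually_summand_eq _ b d c cs) h1 fun v' hv' =>
      mem_polylogAlgebra_of_tendsto (k := 1) (s := s) one_pos (by omega) (by simp) hcs
        (Or.inl rfl) hv')
  exact mul_mem (mul_mem (pochRatio_mem _ n) (multipleHarmonicSum_mem cs n))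
    (ratCast_mem_polylogAlgebra _)

/-- For `q < 0` the identity `(p)_{n+1} = p (p + 1)_n` leads back to a parameter `p + 1` in
`[0, 1)`, with the summation index shifted by one. -/
lemma mem_polylogAlgebra_of_neg {q b d : ℤ} (hq : q < 0) {c : ℕ} {cs : List ℕ}
    (hcs : ∀ k ∈ cs, 1 ≤ k) {v : ℝ}
    (hv : Tendsto (fun N : ℕ => ∑ n ∈ Finset.Icc 1 N, summand q b d c cs n) atTop (𝓝 v)) :
    v ∈ polylogAlgebra := by
  simp only [sum_Icc_one_eq_sum_range] at hv
  have hq' : (q : ℚ) ≠ 0 := by exact_mod_cast hq.ne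
  set p' : ℚ := 1 / q + 1 with hp'
  set T : ℕ → ℝ := fun n => pochRatio p' n * multipleHarmonicSum cs (n + 1) *
    (weight (b + 1) (d + 1) c n : ℝ) with hT
  have hTmem : ∀ n, T n ∈ polylogAlgebra := fun n =>
    mul_mem (mul_mem (pochRatio_mem _ n) (multipleHarmonicSum_mem cs _))
      (ratCast_mem_polylogAlgebra _)
  have hev : (fun n => summand q b d c cs (n + 1)) =ᶠ[atTop]
      fun n => ((1 / q : ℚ) : ℝ) * T n := by
    filter_upwards [(tendsto_add_atTop_nat 1).eventually (eventually_summand_eq q b d c cs)]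
      with n hn
    have h1 := succ_mul_pochRatio_succ_eq ((1 / q : ℚ) : ℝ) n
    have h2 : ((p' : ℚ) : ℝ) = ((1 / q : ℚ) : ℝ) + 1 := by rw [hp']; push_cast; ring
    rw [hn, weight_succ]
    simp only [hT]
    rw [h2, ← mul_assoc, ← mul_assoc, ← h1]
    push_cast
    ring
  refine mem_polylogAlgebra_of_eventuallyEq (fun n => summand_mem q b d c cs (n + 1))
    (fun n => mul_mem (ratCast_mem_polylogAlgebra _) (hTmem n)) hev hv fun v' hv' => ?_
  have hv2 : Tendsto (fun N => ∑ n ∈ Finset.range N, T n) atTop (𝓝 ((q : ℚ) * v')) := by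
    refine (hv'.const_mul ((q : ℚ) : ℝ)).congr fun N => ?_
    rw [Finset.mul_sum]
    refine Finset.sum_congr rfl fun n _ => ?_
    rw [← mul_assoc, ← Rat.cast_mul, mul_one_div_cancel hq', Rat.cast_one, one_mul]
  have hback : v' = ((1 / q : ℚ) : ℝ) * ((q : ℚ) * v') := by
    rw [← mul_assoc, ← Rat.cast_mul, one_div_mul_cancel hq', Rat.cast_one, one_mul]
  rw [hback]
  refine mul_mem (ratCast_mem_polylogAlgebra _) ?_
  obtain ⟨k, rfl⟩ : ∃ k : ℕ, q = -(k + 1 : ℕ) := ⟨(-q - 1).toNat, by omega⟩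
  have hpk : p' = k / (k + 1 : ℕ) := by
    have : (k : ℚ) + 1 ≠ 0 := by positivity
    rw [hp']
    push_cast
    field_simp
    ring
  rcases Nat.eq_zero_or_pos k with rfl | hk
  · -- here `p' = 0`, and all terms but the first vanish
    refine mem_polylogAlgebra_of_eventuallyEq hTmem (fun _ => zero_mem _) ?_ hv2 fun w hw => ?_
    · filter_upwards [eventually_ge_atTop 1] with n hn
      obtain ⟨m, rfl⟩ : ∃ m, n = m + 1 := ⟨n - 1, by omega⟩
      have hz : pochRatio p' (m + 1) = 0 := by
        have := succ_mul_pochRatio_succ_eq (p' : ℝ) m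
        rw [hpk] at this ⊢
        have hm : (m : ℝ) + 1 ≠ 0 := by positivity
        simpa [hm] using this
      simp only [hT]
      rw [hz, zero_mul, zero_mul]
    · have h0 : Tendsto (fun N : ℕ => ∑ _n ∈ Finset.range N, (0 : ℝ)) atTop (𝓝 0) := by simp
      rw [← tendsto_nhds_unique h0 hw]
      exact zero_mem _
  · exact mem_polylogAlgebra_of_tendsto hk (Nat.le_succ k) hpk hcs (Or.inr rfl) hv2

end PochhammerSums

theorem mainTheorem1 (q b d : ℤ) (hq : q ≠ 0) (c : ℕ) (cs : List ℕ) (hcs : ∀ k ∈ cs, 1 ≤ k)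
    (v : ℝ)
    (hv : Filter.Tendsto
      (fun N : ℕ => ∑ n ∈ Finset.Icc 1 N, PochhammerSums.summand q b d c cs n)
      Filter.atTop (nhds v)) :
    v ∈ Algebra.adjoin ℚ PochhammerSums.cyclotomicPolylogsAtOne := by
  rcases lt_or_gt_of_ne hq with h | h
  · exact PochhammerSums.mem_polylogAlgebra_of_neg h hcs hv
  · exact PochhammerSums.mem_polylogAlgebra_of_pos h hcs hv
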